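/- **Setting.** Let $(\Omega_0,P)$ be a probability space, $K\ge 2$ an integer and $A,B,\tau>0$ constants with $KA\le B<1$ and $\tau\le(1-B)/K$. For each $\omega\in\Omega_0$ let $S_1(\omega),\dots,S_K(\omega)$ be similarities of $[0,1]$ into itself with contraction factors $a_1(\omega),\dots,a_K(\omega)$ (measurable in $\omega$) such that $A\le a_j(\omega)\le\sum_{i=1}^K a_i(\omega)\le B$, and such that the sets $S_i(\omega)[0,1]$, $S_j(\omega)[0,1]$ are at distance at least $\tau$ for all $i\ne j$. Let $\boldsymbol\omega=(\boldsymbol\omega_1,\boldsymbol\omega_2,\dots)\in\Omega_0^{\mathbb N}$ be distributed according to the infinite product measure $P^{\mathbb N}$. Put $I_{i_1,\dots,i_n}(\boldsymbol\omega)=S_{i_1}(\boldsymbol\omega_1)\circ\cdots\circ S_{i_n}(\boldsymbol\omega_n)[0,1]$ and $$F_{\boldsymbol\omega}=\bigcap_n\bigcup_{i_1,\dots,i_n}I_{i_1,\dots,i_n}(\boldsymbol\omega).$$ Given measurable probability weights $p_j(\omega)\ge 0$, $\sum_{j=1}^K p_j(\omega)=1$, with $\mathbb E(p_j^{-t})<\infty$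 for all $j$ for some $t>0$, let $\mu_{\boldsymbol\omega}$ be the Borel probability measure with $\mu_{\boldsymbol\omega}(I_{i_1,\dots,i_n}(\boldsymbol\omega))=p_{i_1}(\boldsymbol\omega_1)\cdots p_{i_n}(\boldsymbol\omega_n)$. Let $d_\omega\ge 0$ be the solution of $\sum_{j=1}^K a_j(\omega)^{d_\omega}=1$, and let $D=\operatorname{ess\,sup}_{\omega}d_\omega$, $d=\operatorname{ess\,inf}_\omega d_\omega$. A *dimension function* is a map $\Phi:(0,1)\to[0,\infty)$ such that $t^{1+\Phi(t)}$ decreases to $0$ as $t$ decreases to $0$; it is *small* if $\Phi(t)=H(t)\,\log|\log t|/|\log t|$ for $t$ near $0$, where $H(t)\to0$ as $t\to 0$. Let $N_r(E)$ be the least number of open balls of radius $r$ needed to cover $E$. The upper $\Phi$-dimension $\overline{\dim}_\Phi E$ of a set $E$ is the infimum of all $s$ for which there are $C_1\in(0,1)$, $C_2>0$ with $N_r(B(z,R)\cap E)\le C_2(R/r)^s$ whenever $0<r\le R^{1+\Phi(R)}\le R<C_1$ and $z\in E$; the lower $\Phi$-dimension $\underline{\dim}_\Phi E$ is the supremum of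 all $s$ for which there are such $C_1,C_2$ with $N_r(B(z,R)\cap E)\ge C_2(R/r)^s$ for all these $r,R,z$. The upper $\Phi$-dimension $\overline{\dim}_\Phi\mu$ of a measure $\mu$ is the infimum of all $s$ for which there are $C_1\in(0,1)$, $C_2>0$ with $\mu(B(x,R))/\mu(B(x,r))\le C_2(R/r)^s$ whenever $0<r<R^{1+\Phi(R)}\le R\le C_1$ and $x\in\operatorname{supp}\mu$; $\underline{\dim}_\Phi\mu$ is the supremum of all $s$ for which there are such $C_1,C_2$ with $\ge$ in place of $\le$ in the bound on $\mu(B(x,R))/\mu(B(x,r))$. **Theorem.** (i) For every $r\in[D,\infty)$ there are probability weights $p_1(\omega),\dots,p_K(\omega)$ as above, strictly bounded away from zero uniformly in $\omega$ and depending measurably on the contraction factors $a_1(\omega),\dots,a_K(\omega)$ only, such that for $P^{\mathbb N}$-almost every $\boldsymbol\omega$, simultaneously for all small dimension functions $\Phi$, $$\overline{\dim}_\Phi\mu_{\boldsymbol\omega}=r\ge\overline{\dim}_\Phi F_{\boldsymbol\omega}.$$ (ii) For every $r\in(0,d]$ there are such weights for which, for $P^{\mathbb N}$-almost every $\boldsymbol\omega$,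 simultaneously for all small dimension functions $\Phi$, $$\underline{\dim}_\Phi\mu_{\boldsymbol\omega}=r\le\underline{\dim}_\Phi F_{\boldsymbol\omega}.$$ In both cases the weights can be taken to be $p_1(\omega)=a_1(\omega)^r$ and $p_j(\omega)=a_j(\omega)^{r_\omega}$ for $j=2,\dots,K$, where $r_\omega$ is the real number for which the weights sum to $1$. -/

import Mathlib

open Set Filter Topology MeasureTheory
open scoped ENNReal

noncomputable section

namespace RandomMoran

/-! ### Dimension functions and Φ-dimensions -/

/-- A dimension function `Φ : (0,1) → [0,∞)`: the function `t ^ (1 + Φ t)` decreases to `0` as `t`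
decreases to `0`. Values of `Φ` outside `(0,1)` are irrelevant. -/
structure IsDimensionFunction (Φ : ℝ → ℝ) : Prop where
  nonneg : ∀ t ∈ Ioo (0 : ℝ) 1, 0 ≤ Φ t
  mono : MonotoneOn (fun t : ℝ => t ^ (1 + Φ t)) (Ioo 0 1)
  tendsto : Tendsto (fun t : ℝ => t ^ (1 + Φ t)) (𝓝[>] 0) (𝓝 0)

/-- `Φ` is small: `Φ t = H t * log |log t| / |log t|` for `t` near `0`, where `H t → 0`. -/
def IsSmall (Φ : ℝ → ℝ) : Prop :=
  ∃ H : ℝ → ℝ, Tendsto H (𝓝[>] 0) (𝓝 0) ∧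
    ∀ᶠ t in 𝓝[>] (0 : ℝ), Φ t = H t * (Real.log |Real.log t| / |Real.log t|)

section Dimensions

variable {X : Type*} [MetricSpace X]

/-- The least number of open balls of radius `r` needed to cover `E` (`⊤` if no finite number
suffices). -/
def coveringNumber (r : ℝ) (E : Set X) : ℕ∞ :=
  ⨅ (T : Set X) (_ : E ⊆ ⋃ x ∈ T, Metric.ball x r), T.encard

/-- The upper Φ-dimension of a set. -/
def upperDimSet (Φ : ℝ → ℝ) (E : Set X) : EReal :=
  sInf ((fun s : ℝ => (s : EReal)) '' {s : ℝ | ∃ C₁ C₂ : ℝ, 0 < C₁ ∧ C₁ < 1 ∧ 0 < C₂ ∧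
    ∀ r R : ℝ, 0 < r → r ≤ R ^ (1 + Φ R) → R ^ (1 + Φ R) ≤ R → R < C₁ → ∀ z ∈ E,
      (coveringNumber r (Metric.ball z R ∩ E) : ℝ≥0∞) ≤ ENNReal.ofReal (C₂ * (R / r) ^ s)})

/-- The lower Φ-dimension of a set. -/
def lowerDimSet (Φ : ℝ → ℝ) (E : Set X) : EReal :=
  sSup ((fun s : ℝ => (s : EReal)) '' {s : ℝ | ∃ C₁ C₂ : ℝ, 0 < C₁ ∧ C₁ < 1 ∧ 0 < C₂ ∧
    ∀ r R : ℝ, 0 < r → r ≤ R ^ (1 + Φ R) → R ^ (1 + Φ R) ≤ R → R < C₁ → ∀ z ∈ E,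
      ENNReal.ofReal (C₂ * (R / r) ^ s) ≤ (coveringNumber r (Metric.ball z R ∩ E) : ℝ≥0∞)})

variable [MeasurableSpace X]

/-- The upper Φ-dimension of a measure. -/
def upperDimMeasure (Φ : ℝ → ℝ) (μ : Measure X) : EReal :=
  sInf ((fun s : ℝ => (s : EReal)) '' {s : ℝ | ∃ C₁ C₂ : ℝ, 0 < C₁ ∧ C₁ < 1 ∧ 0 < C₂ ∧
    ∀ r R : ℝ, 0 < r → r < R ^ (1 + Φ R) → R ^ (1 + Φ R) ≤ R → R ≤ C₁ → ∀ x ∈ μ.support,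
      μ (Metric.ball x R) / μ (Metric.ball x r) ≤ ENNReal.ofReal (C₂ * (R / r) ^ s)})

/-- The lower Φ-dimension of a measure. -/
def lowerDimMeasure (Φ : ℝ → ℝ) (μ : Measure X) : EReal :=
  sSup ((fun s : ℝ => (s : EReal)) '' {s : ℝ | ∃ C₁ C₂ : ℝ, 0 < C₁ ∧ C₁ < 1 ∧ 0 < C₂ ∧
    ∀ r R : ℝ, 0 < r → r < R ^ (1 + Φ R) → R ^ (1 + Φ R) ≤ R → R ≤ C₁ → ∀ x ∈ μ.support,
      ENNReal.ofReal (C₂ * (R / r) ^ s) ≤ μ (Metric.ball x R) / μ (Metric.ball x r)})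

end Dimensions

/-! ### Random iterated function systems -/

/-- A random iterated function system: for every `ω` there are `K` similarities `S j ω` of `[0,1]`
into itself with contraction factors `a j ω`, such that `A ≤ a j ω`, the factors have sum at most
`B`, and the images of `[0,1]` are at distance at least `τ` from each other. -/
structure RandomIFS (Ω₀ : Type*) [MeasurableSpace Ω₀] (K : ℕ) (A B τ : ℝ) where
  /-- the contraction factors -/
  a : Fin K → Ω₀ → ℝ
  /-- the similarities (only their values on `[0,1]` matter) -/
  S : Fin K → Ω₀ → ℝ → ℝ
  measurable_a : ∀ j, Measurable (a j)
  le_a : ∀ j ω, A ≤ a j ω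
  sum_a_le : ∀ ω, ∑ j, a j ω ≤ B
  mapsTo : ∀ j ω, MapsTo (S j ω) (Icc 0 1) (Icc 0 1)
  similarity : ∀ j ω, ∀ x ∈ Icc (0 : ℝ) 1, ∀ y ∈ Icc (0 : ℝ) 1,
    dist (S j ω x) (S j ω y) = a j ω * dist x y
  separated : ∀ i j ω, i ≠ j → ∀ x ∈ Icc (0 : ℝ) 1, ∀ y ∈ Icc (0 : ℝ) 1,
    τ ≤ dist (S i ω x) (S j ω y)

/-- `p` is an admissible random choice of probability weights: it is measurable and there is `t > 0`
such that `p i` has a finite moment of order `-t` for every `i` (where `0 ^ (-t) = ∞`). -/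
def IsAdmissible {Ω₀ : Type*} [MeasurableSpace Ω₀] {K : ℕ} (P : Measure Ω₀)
    (p : Ω₀ → stdSimplex ℝ (Fin K)) : Prop :=
  Measurable p ∧ ∃ t : ℝ, 0 < t ∧ ∀ i, ∫⁻ ω, ENNReal.ofReal ((p ω).1 i) ^ (-t) ∂P < ∞

/-- The exponent `s ≥ 0` with `∑ j, c j ^ s = 1`. It exists and is unique for all families of
contraction factors considered here, see `existsUnique_moranExponent`. -/
def moranExponent {K : ℕ} (c : Fin K → ℝ) : ℝ :=
  sInf {s : ℝ | 0 ≤ s ∧ ∑ j, c j ^ s = 1}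

theorem existsUnique_moranExponent {K : ℕ} (hK : 2 ≤ K) (c : Fin K → ℝ) (hpos : ∀ j, 0 < c j)
    (hsum : ∑ j, c j < 1) : ∃! s : ℝ, 0 ≤ s ∧ ∑ j, c j ^ s = 1 := by
  have hne : Nonempty (Fin K) := ⟨⟨0, by omega⟩⟩
  have hlt : ∀ j, c j < 1 := fun j =>
    (Finset.single_le_sum (fun i _ => (hpos i).le) (Finset.mem_univ j)).trans_lt hsum
  have hanti : StrictAnti fun s : ℝ => ∑ j, c j ^ s := fun s t hst =>
    Finset.sum_lt_sum_of_nonempty Finset.univ_nonempty fun j _ =>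
      Real.rpow_lt_rpow_of_exponent_gt (hpos j) (hlt j) hst
  have hcont : Continuous fun s : ℝ => ∑ j, c j ^ s :=
    continuous_finsetSum _ fun j _ => Real.continuous_const_rpow (hpos j).ne'
  have h0 : (1 : ℝ) ≤ ∑ j, c j ^ (0 : ℝ) := by
    simp only [Real.rpow_zero, Finset.sum_const, Finset.card_univ, Fintype.card_fin, nsmul_eq_mul,
      mul_one]
    exact_mod_cast (by omega : 1 ≤ K)
  have h1 : ∑ j, c j ^ (1 : ℝ) ≤ 1 := by simpa using hsum.le
  obtain ⟨s, hs, hs1⟩ := intermediate_value_Icc' zero_le_one hcont.continuousOn ⟨h1, h0⟩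
  exact ⟨s, ⟨hs.1, hs1⟩, fun t ht => hanti.injective (ht.2.trans hs1.symm)⟩

/-- The probability measure on `{1, …, K}` with weights `p`. -/
def weightMeasure {K : ℕ} (p : stdSimplex ℝ (Fin K)) : Measure (Fin K) :=
  ∑ j, ENNReal.ofReal (p.1 j) • Measure.dirac j

instance {K : ℕ} (p : stdSimplex ℝ (Fin K)) : IsProbabilityMeasure (weightMeasure p) := by
  constructor
  simp only [weightMeasure, Measure.coe_finsetSum, Finset.sum_apply, Measure.smul_apply,
    measure_univ, smul_eq_mul, mul_one]
  rw [← ENNReal.ofReal_sum_of_nonneg fun i _ => p.2.1 i, p.2.2, ENNReal.ofReal_one]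

theorem weightMeasure_singleton {K : ℕ} (p : stdSimplex ℝ (Fin K)) (j : Fin K) :
    weightMeasure p {j} = ENNReal.ofReal (p.1 j) := by
  simp [weightMeasure, Set.indicator_apply]

section Construction

variable {Ω₀ : Type*} [MeasurableSpace Ω₀] {K : ℕ} {A B τ : ℝ}

/-- The map `S_{i 0}(ω 0) ∘ ⋯ ∘ S_{i (n-1)}(ω (n-1))`; sequences are indexed from `0`. -/
def moranMap (I : RandomIFS Ω₀ K A B τ) (ω : ℕ → Ω₀) (i : ℕ → Fin K) : ℕ → ℝ → ℝ
  | 0 => id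
  | n + 1 => moranMap I ω i n ∘ I.S (i n) (ω n)

/-- The step `n` Moran interval of the word `i 0, …, i (n-1)`. -/
def moranInterval (I : RandomIFS Ω₀ K A B τ) (ω : ℕ → Ω₀) (i : ℕ → Fin K) (n : ℕ) : Set ℝ :=
  moranMap I ω i n '' Icc 0 1

/-- The random Moran set `F_ω`. -/
def moranSet (I : RandomIFS Ω₀ K A B τ) (ω : ℕ → Ω₀) : Set ℝ :=
  ⋂ n : ℕ, ⋃ i : ℕ → Fin K, moranInterval I ω i n

/-- The point of the Moran set with address `i`. -/
def codingMap (I : RandomIFS Ω₀ K A B τ) (ω : ℕ → Ω₀) (i : ℕ → Fin K) : ℝ :=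
  limUnder atTop fun n => moranMap I ω i n 0

/-- The random Moran measure `μ_ω`: the law of the point whose address has independent digits, the
`n`-th one distributed according to the weights `p (ω n)`. It is the measure that gives mass
`p_{i 0}(ω 0) ⋯ p_{i (n-1)}(ω (n-1))` to each step `n` Moran interval, see
`moranMeasure_moranInterval`. -/
def moranMeasure (I : RandomIFS Ω₀ K A B τ) (p : Ω₀ → stdSimplex ℝ (Fin K)) (ω : ℕ → Ω₀) :
    Measure ℝ :=
  (Measure.infinitePi fun n => weightMeasure (p (ω n))).map (codingMap I ω)

theorem moranMap_mapsTo (I : RandomIFS Ω₀ K A B τ) (ω : ℕ → Ω₀) (i : ℕ → Fin K) (n : ℕ) :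
    MapsTo (moranMap I ω i n) (Icc 0 1) (Icc 0 1) := by
  induction n with
  | zero => exact fun x hx => hx
  | succ n ih => exact ih.comp (I.mapsTo _ _)

theorem moranInterval_succ_subset (I : RandomIFS Ω₀ K A B τ) (ω : ℕ → Ω₀) (i : ℕ → Fin K)
    (n : ℕ) : moranInterval I ω i (n + 1) ⊆ moranInterval I ω i n := by
  rintro _ ⟨x, hx, rfl⟩
  exact ⟨I.S (i n) (ω n) x, I.mapsTo _ _ hx, rfl⟩

theorem moranInterval_antitone (I : RandomIFS Ω₀ K A B τ) (ω : ℕ → Ω₀) (i : ℕ → Fin K) :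
    Antitone (moranInterval I ω i) :=
  antitone_nat_of_succ_le (moranInterval_succ_subset I ω i)

theorem dist_moranMap (I : RandomIFS Ω₀ K A B τ) (ω : ℕ → Ω₀) (i : ℕ → Fin K) (n : ℕ) {x y : ℝ}
    (hx : x ∈ Icc (0 : ℝ) 1) (hy : y ∈ Icc (0 : ℝ) 1) :
    dist (moranMap I ω i n x) (moranMap I ω i n y) =
      (∏ k ∈ Finset.range n, I.a (i k) (ω k)) * dist x y := by
  induction n generalizing x y with
  | zero => simp [moranMap]
  | succ n ih =>
    rw [moranMap, Function.comp_apply, Function.comp_apply, ih (I.mapsTo _ _ hx) (I.mapsTo _ _ hy),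
      I.similarity _ _ x hx y hy, Finset.prod_range_succ, mul_assoc]

theorem a_le (I : RandomIFS Ω₀ K A B τ) (hA : 0 < A) (j : Fin K) (ω : Ω₀) : I.a j ω ≤ B :=
  (Finset.single_le_sum (f := fun j => I.a j ω) (fun k _ => hA.le.trans (I.le_a k ω))
    (Finset.mem_univ j)).trans (I.sum_a_le ω)

theorem isCompact_moranInterval (I : RandomIFS Ω₀ K A B τ) (ω : ℕ → Ω₀) (i : ℕ → Fin K) (n : ℕ) :
    IsCompact (moranInterval I ω i n) := by
  refine isCompact_Icc.image_of_continuousOn (LipschitzOnWith.continuousOn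
    (K := Real.toNNReal (∏ k ∈ Finset.range n, I.a (i k) (ω k))) ?_)
  refine LipschitzOnWith.of_dist_le_mul fun x hx y hy => ?_
  rw [dist_moranMap I ω i n hx hy]
  gcongr
  exact Real.le_coe_toNNReal _

theorem tendsto_codingMap (I : RandomIFS Ω₀ K A B τ) (hA : 0 < A) (hB : B < 1) (ω : ℕ → Ω₀)
    (i : ℕ → Fin K) : Tendsto (fun n => moranMap I ω i n 0) atTop (𝓝 (codingMap I ω i)) := by
  have hB0 : 0 ≤ B := (hA.le.trans (I.le_a _ _)).trans (a_le I hA (i 0) (ω 0))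
  have h0 : (0 : ℝ) ∈ Icc (0 : ℝ) 1 := by simp
  refine CauchySeq.tendsto_limUnder (cauchySeq_of_le_geometric B 1 hB fun n => ?_)
  rw [moranMap, Function.comp, dist_moranMap I ω i n h0 (I.mapsTo _ _ h0), one_mul]
  have h1 : dist (0 : ℝ) (I.S (i n) (ω n) 0) ≤ 1 := by
    have := I.mapsTo (i n) (ω n) h0
    rw [Real.dist_eq, abs_le]
    constructor <;> linarith [this.1, this.2]
  have h2 : ∏ k ∈ Finset.range n, I.a (i k) (ω k) ≤ B ^ n := by
    calc _ ≤ ∏ k ∈ Finset.range n, B :=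
          Finset.prod_le_prod (fun k _ => hA.le.trans (I.le_a _ _)) fun k _ => a_le I hA _ _
      _ = B ^ n := by simp
  calc _ ≤ B ^ n * 1 := by gcongr
    _ = B ^ n := mul_one _

theorem codingMap_mem (I : RandomIFS Ω₀ K A B τ) (hA : 0 < A) (hB : B < 1) (ω : ℕ → Ω₀)
    (i : ℕ → Fin K) (n : ℕ) : codingMap I ω i ∈ moranInterval I ω i n := by
  refine (isCompact_moranInterval I ω i n).isClosed.mem_of_tendsto (tendsto_codingMap I hA hB ω i)
    ((eventually_ge_atTop n).mono fun m hm => ?_)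
  exact moranInterval_antitone I ω i hm ⟨0, by simp, rfl⟩

theorem moranMap_congr (I : RandomIFS Ω₀ K A B τ) (ω : ℕ → Ω₀) {i i' : ℕ → Fin K} {n : ℕ}
    (h : ∀ k < n, i k = i' k) : moranMap I ω i n = moranMap I ω i' n := by
  induction n with
  | zero => rfl
  | succ n ih =>
    rw [moranMap, moranMap, ih fun k hk => h k (by omega), h n (by omega)]

theorem eq_of_mem_moranInterval (I : RandomIFS Ω₀ K A B τ) (hA : 0 < A) (hτ : 0 < τ)
    (ω : ℕ → Ω₀) {i i' : ℕ → Fin K} {n : ℕ} {x : ℝ} (h : x ∈ moranInterval I ω i n)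
    (h' : x ∈ moranInterval I ω i' n) : ∀ k < n, i k = i' k := by
  induction n with
  | zero => intro k hk; omega
  | succ n ih =>
    have hn := ih (moranInterval_succ_subset I ω i n h) (moranInterval_succ_subset I ω i' n h')
    intro k hk
    rcases Nat.lt_succ_iff_lt_or_eq.1 hk with hk | rfl
    · exact hn k hk
    by_contra hne
    obtain ⟨u, hu, rfl⟩ := h
    obtain ⟨v, hv, huv⟩ := h'
    rw [moranMap, moranMap, moranMap_congr I ω hn, Function.comp, Function.comp] at huv
    have h1 := dist_moranMap I ω i' k (I.mapsTo (i' k) (ω k) hv) (I.mapsTo (i k) (ω k) hu)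
    rw [huv, dist_self] at h1
    have h2 := I.separated _ _ (ω k) (Ne.symm hne) v hv u hu
    have h3 : 0 < ∏ m ∈ Finset.range k, I.a (i' m) (ω m) :=
      Finset.prod_pos fun m _ => hA.trans_le (I.le_a _ _)
    have := mul_pos h3 (hτ.trans_le h2)
    linarith

theorem measurable_moranMap (I : RandomIFS Ω₀ K A B τ) (ω : ℕ → Ω₀) (n : ℕ) (x : ℝ) :
    Measurable fun i : ℕ → Fin K => moranMap I ω i n x := by
  induction n generalizing x with
  | zero => exact measurable_const
  | succ n ih =>
    have h : Measurable fun q : Fin K × (ℕ → Fin K) => moranMap I ω q.2 n (I.S q.1 (ω n) x) :=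
      measurable_from_prod_countable_right fun j => ih (I.S j (ω n) x)
    exact h.comp (f := fun i : ℕ → Fin K => (i n, i)) ((measurable_pi_apply n).prodMk measurable_id)

theorem measurable_codingMap (I : RandomIFS Ω₀ K A B τ) (hA : 0 < A) (hB : B < 1) (ω : ℕ → Ω₀) :
    Measurable (codingMap I ω) :=
  measurable_of_tendsto_metrizable (fun n => measurable_moranMap I ω n 0)
    (tendsto_pi_nhds.2 fun i => tendsto_codingMap I hA hB ω i)

/-- The rule that determines the random Moran measure. -/
theorem moranMeasure_moranInterval (I : RandomIFS Ω₀ K A B τ) (hA : 0 < A) (hB : B < 1)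
    (hτ : 0 < τ) (p : Ω₀ → stdSimplex ℝ (Fin K)) (ω : ℕ → Ω₀) (i : ℕ → Fin K) (n : ℕ) :
    moranMeasure I p ω (moranInterval I ω i n) =
      ∏ k ∈ Finset.range n, ENNReal.ofReal ((p (ω k)).1 (i k)) := by
  rw [moranMeasure, Measure.map_apply (measurable_codingMap I hA hB ω)
    (isCompact_moranInterval I ω i n).measurableSet]
  have : codingMap I ω ⁻¹' moranInterval I ω i n =
      Set.pi (Finset.range n : Set ℕ) fun k => {i k} := by
    ext i'
    simp only [mem_preimage, Set.mem_pi, Finset.coe_range, mem_Iio, mem_singleton_iff]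
    refine ⟨eq_of_mem_moranInterval I hA hτ ω (codingMap_mem I hA hB ω i' n), fun h => ?_⟩
    have := codingMap_mem I hA hB ω i' n
    rwa [moranInterval, moranMap_congr I ω h] at this
  rw [this, Measure.infinitePi_pi _ fun k _ => measurableSet_singleton _]
  exact Finset.prod_congr rfl fun k _ => weightMeasure_singleton _ _

theorem isProbabilityMeasure_moranMeasure (I : RandomIFS Ω₀ K A B τ) (hA : 0 < A) (hB : B < 1)
    (p : Ω₀ → stdSimplex ℝ (Fin K)) (ω : ℕ → Ω₀) : IsProbabilityMeasure (moranMeasure I p ω) :=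
  Measure.isProbabilityMeasure_map (measurable_codingMap I hA hB ω).aemeasurable

end Construction

end RandomMoran

end

open Set Filter Topology MeasureTheory
open scoped ENNReal

noncomputable section

namespace RandomMoran

/-! ### Covering numbers and measures of balls -/

section MetricMeasure

/-! The weights turn a condition on Moran exponents into a digitwise one. If `moranExponent a ≤ r`,
then `∑ j, a j ^ r ≤ 1`. Once the first weight is fixed as `a 0 ^ r`, the common exponent of the
others must be at most `r` for the sum to reach `1`, so every weight is at least `a j ^ r`. If `r ≤
moranExponent a`, all inequalities reverse. Under the bound on the essential supremum or infimum,
almost every sequence has this property at all its coordinates.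

Multiplying digitwise inequalities compares mass ratios of nested Moran intervals with the power `r`
of their length ratios. Strong separation makes balls centred in the Moran set comparable with Moran
intervals, so the same comparison holds for concentric balls at all scales below `A * τ`
(`ballRatioLE_moranMeasure`, `ballRatioGE_moranMeasure`). These estimates do not involve `Φ`, hence
one null set serves all `Φ`. They give one bound for the dimension of the measure. The other comes
from the single point with constant address `0`: there each weight equals `a 0 ^ r`, so the power
law holds in both directions (`le_upperDimMeasure`, `lowerDimMeasure_le`).

For the Moran set, which is the support of the measure, ball ratios control covering numbers: by
packing from above (`BallRatioLE.card_separated_le`), and by summing the masses of covering balls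
from below (`BallRatioGE.rpow_le_card_mul`). -/

theorem measure_div_eq_ofReal {Y : Type*} [MeasurableSpace Y] {μ : Measure Y} [IsFiniteMeasure μ]
    {a b : Set Y} (hb : 0 < μ.real b) : μ a / μ b = ENNReal.ofReal (μ.real a / μ.real b) := by
  rw [ENNReal.ofReal_div_of_pos hb, ofReal_measureReal, ofReal_measureReal]

variable {X : Type*} [MetricSpace X]

theorem coveringNumber_le_encard {r : ℝ} {E T : Set X} (h : E ⊆ ⋃ x ∈ T, Metric.ball x r) :
    coveringNumber r E ≤ T.encard :=
  iInf₂_le T h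

/-- A bound for the cardinality of the `r`-separated subsets of `E` is a bound for the covering
number. -/
theorem coveringNumber_le_of_card_separated_le {r : ℝ} (hr : 0 < r) {E : Set X} {N : ℕ}
    (h : ∀ S : Finset X, (S : Set X) ⊆ E → (∀ x ∈ S, ∀ y ∈ S, x ≠ y → r ≤ dist x y) →
      S.card ≤ N) : coveringNumber r E ≤ N := by
  classical
  by_contra hcon
  -- Greedy choice: as long as at most `N` points are chosen, their balls miss a point of `E`, and
  -- that point can be added.
  have key : ∀ n ≤ N + 1, ∃ S : Finset X, (S : Set X) ⊆ E ∧
      (∀ x ∈ S, ∀ y ∈ S, x ≠ y → r ≤ dist x y) ∧ S.card = n := by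
    intro n
    induction n with
    | zero => exact fun _ => ⟨∅, by simp, by simp, by simp⟩
    | succ n ih =>
      intro hn
      obtain ⟨S, hSE, hS, hcard⟩ := ih (by omega)
      have hcov : ¬ E ⊆ ⋃ x ∈ (S : Set X), Metric.ball x r := fun hcov => by
        refine hcon ((coveringNumber_le_encard hcov).trans ?_)
        rw [Set.encard_coe_eq_coe_finsetCard, hcard]
        exact_mod_cast (by omega : n ≤ N)
      obtain ⟨y, hyE, hy⟩ := Set.not_subset.1 hcov
      simp only [mem_iUnion, Metric.mem_ball, not_exists, not_lt, Finset.mem_coe] at hy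
      have hyS : y ∉ S := fun hmem => by
        have := hy y hmem
        rw [dist_self] at this
        linarith
      refine ⟨insert y S, ?_, ?_, by rw [Finset.card_insert_of_notMem hyS, hcard]⟩
      · intro x hx
        rcases Finset.mem_insert.1 (Finset.mem_coe.1 hx) with rfl | hx
        · exact hyE
        · exact hSE hx
      · intro u hu v hv huv
        rcases Finset.mem_insert.1 hu with rfl | hu' <;>
          rcases Finset.mem_insert.1 hv with rfl | hv'
        · exact absurd rfl huv
        · exact hy v hv'
        · rw [dist_comm]
          exact hy u hu'
        · exact hS u hu' v hv' huv
  obtain ⟨S, hSE, hS, hcard⟩ := key (N + 1) le_rfl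
  have := h S hSE hS
  omega

variable [MeasurableSpace X] {μ : Measure X} [IsFiniteMeasure μ]

/-- The ratio of the measures of concentric balls with centres in `F` and radii `r ≤ R ≤ R₀` is at
most `C * (R / r) ^ s`. -/
def BallRatioLE (μ : Measure X) (F : Set X) (R₀ C s : ℝ) : Prop :=
  ∀ x ∈ F, ∀ r R : ℝ, 0 < r → r ≤ R → R ≤ R₀ →
    μ.real (Metric.ball x R) ≤ C * (R / r) ^ s * μ.real (Metric.ball x r)

/-- The ratio of the measures of concentric balls with centres in `F` and radii `r ≤ R ≤ R₀` is at
least `C⁻¹ * (R / r) ^ s`. -/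
def BallRatioGE (μ : Measure X) (F : Set X) (R₀ C s : ℝ) : Prop :=
  ∀ x ∈ F, ∀ r R : ℝ, 0 < r → r ≤ R → R ≤ R₀ →
    (R / r) ^ s * μ.real (Metric.ball x r) ≤ C * μ.real (Metric.ball x R)

variable {F : Set X} {R₀ C s : ℝ}

/-- Packing: the balls of radius `r / 2` about separated points are disjoint and lie in `ball z (2 *
R)`. Each carries a definite share of the mass of `ball z R`, because `ball x (2 * R)` contains that
ball. The factor `C * 2 ^ s` pays for returning from radius `2 * R` to `R`. -/
theorem BallRatioLE.card_separated_le [OpensMeasurableSpace X] (h : BallRatioLE μ F R₀ C s)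
    (hC : 0 ≤ C) {z : X} (hz : z ∈ F) {r R : ℝ} (hr : 0 < r) (hrR : r ≤ R) (hR : 2 * R ≤ R₀)
    (hpos : 0 < μ.real (Metric.ball z R)) (S : Finset X)
    (hSE : (S : Set X) ⊆ Metric.ball z R ∩ F)
    (hS : ∀ x ∈ S, ∀ y ∈ S, x ≠ y → r ≤ dist x y) :
    (S.card : ℝ) ≤ C * 4 ^ s * (C * 2 ^ s) * (R / r) ^ s := by
  have hR0 : 0 < R := hr.trans_le hrR
  have h1 : ∀ x ∈ S, μ.real (Metric.ball z R) ≤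
      C * (4 * (R / r)) ^ s * μ.real (Metric.ball x (r / 2)) := by
    intro x hx
    have hxE := hSE hx
    have h2 := h x hxE.2 (r / 2) (2 * R) (by linarith) (by linarith) hR
    have h3 : 2 * R / (r / 2) = 4 * (R / r) := by field_simp; norm_num
    rw [h3] at h2
    refine le_trans (measureReal_mono (Metric.ball_subset_ball' ?_)) h2
    have := Metric.mem_ball'.1 hxE.1
    linarith
  have hdisj : (S : Set X).PairwiseDisjoint fun x => Metric.ball x (r / 2) := fun x hx y hy hxy =>
    Metric.ball_disjoint_ball (by have := hS x hx y hy hxy; linarith)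
  have h4 : ∑ x ∈ S, μ.real (Metric.ball x (r / 2)) ≤ μ.real (Metric.ball z (2 * R)) := by
    rw [← measureReal_biUnion_finset hdisj fun x _ => measurableSet_ball]
    refine measureReal_mono (iUnion₂_subset fun x hx => Metric.ball_subset_ball' ?_)
    have := Metric.mem_ball.1 (hSE hx).1
    linarith
  have h5 := h z hz R (2 * R) hR0 (by linarith) hR
  have h6 : 2 * R / R = 2 := by field_simp
  rw [h6] at h5
  have h7 : (S.card : ℝ) * μ.real (Metric.ball z R) ≤
      (C * 4 ^ s * (C * 2 ^ s) * (R / r) ^ s) * μ.real (Metric.ball z R) := by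
    calc (S.card : ℝ) * μ.real (Metric.ball z R) = ∑ x ∈ S, μ.real (Metric.ball z R) := by simp
      _ ≤ ∑ x ∈ S, C * (4 * (R / r)) ^ s * μ.real (Metric.ball x (r / 2)) :=
          Finset.sum_le_sum h1
      _ = C * (4 * (R / r)) ^ s * ∑ x ∈ S, μ.real (Metric.ball x (r / 2)) := by
          rw [Finset.mul_sum]
      _ ≤ C * (4 * (R / r)) ^ s * (C * 2 ^ s * μ.real (Metric.ball z R)) := by
          gcongr
          exact h4.trans h5
      _ = _ := by
          rw [Real.mul_rpow (by norm_num) (by positivity)]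
          ring
  exact le_of_mul_le_mul_right h7 hpos

/-- Each covering ball captures little of the mass of `ball z R`, so many are needed. Their centres
may lie outside `F`, so each is enlarged to a ball of radius `2 * r` about a point of `F`. The
second hypothesis `hd` acts as a doubling condition, bringing radius `4 * R` back to `R`; its
exponent `q` affects only the constant. -/
theorem BallRatioGE.rpow_le_card_mul (h : BallRatioGE μ F R₀ C s) {q C' : ℝ}
    (hC : 0 ≤ C) (hd : BallRatioLE μ F R₀ C' q) (hC' : 0 ≤ C') (hF : μ Fᶜ = 0) {z : X}
    (hz : z ∈ F) {r R : ℝ} (hr : 0 < r) (hrR : r ≤ R) (hR : 4 * R ≤ R₀)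
    (hpos : 0 < μ.real (Metric.ball z R)) (T : Finset X)
    (hT : Metric.ball z R ∩ F ⊆ ⋃ x ∈ T, Metric.ball x r) :
    (R / r) ^ s ≤ C * (C' * 4 ^ q) * T.card := by
  have hR0 : 0 < R := hr.trans_le hrR
  have hq : μ.real (Metric.ball z (4 * R)) ≤ C' * 4 ^ q * μ.real (Metric.ball z R) := by
    have h1 := hd z hz R (4 * R) hR0 (by linarith) hR
    rwa [show 4 * R / R = 4 by field_simp] at h1
  have h1 : ∀ t ∈ T, (R / r) ^ s * μ.real (Metric.ball t r ∩ (Metric.ball z R ∩ F)) ≤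
      C * (C' * 4 ^ q) * μ.real (Metric.ball z R) := by
    intro t _
    rcases (Metric.ball t r ∩ (Metric.ball z R ∩ F)).eq_empty_or_nonempty with he | ⟨x, hx⟩
    · rw [he, measureReal_empty, mul_zero]
      positivity
    · have hxt := Metric.mem_ball'.1 hx.1
      have hxz := Metric.mem_ball.1 hx.2.1
      have h2 := h x hx.2.2 (2 * r) (2 * R) (by linarith) (by linarith) (by linarith)
      rw [show 2 * R / (2 * r) = R / r by field_simp] at h2
      calc _ ≤ (R / r) ^ s * μ.real (Metric.ball x (2 * r)) := by
            gcongr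
            · exact measure_ne_top _ _
            · exact inter_subset_left.trans (Metric.ball_subset_ball' (by linarith))
        _ ≤ C * μ.real (Metric.ball x (2 * R)) := h2
        _ ≤ C * μ.real (Metric.ball z (4 * R)) := by
            gcongr
            · exact measure_ne_top _ _
            · exact Metric.ball_subset_ball' (by linarith)
        _ ≤ C * (C' * 4 ^ q * μ.real (Metric.ball z R)) := by gcongr
        _ = _ := by ring
  have h3 : μ.real (Metric.ball z R) ≤
      ∑ t ∈ T, μ.real (Metric.ball t r ∩ (Metric.ball z R ∩ F)) := by
    have h4 : μ (Metric.ball z R) = μ (Metric.ball z R ∩ F) :=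
      (measure_inter_conull' (by
        exact measure_mono_null (fun x hx => hx.2) hF)).symm
    rw [measureReal_def, h4, ← measureReal_def]
    refine le_trans (measureReal_mono (fun x hx => ?_) (measure_ne_top _ _))
      (measureReal_biUnion_finset_le _ _)
    obtain ⟨t, ht, hxt⟩ := mem_iUnion₂.1 (hT hx)
    exact mem_iUnion₂.2 ⟨t, ht, hxt, hx⟩
  refine le_of_mul_le_mul_right ?_ hpos
  calc (R / r) ^ s * μ.real (Metric.ball z R)
      ≤ (R / r) ^ s * ∑ t ∈ T, μ.real (Metric.ball t r ∩ (Metric.ball z R ∩ F)) := by gcongr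
    _ = ∑ t ∈ T, (R / r) ^ s * μ.real (Metric.ball t r ∩ (Metric.ball z R ∩ F)) := by
        rw [Finset.mul_sum]
    _ ≤ ∑ t ∈ T, C * (C' * 4 ^ q) * μ.real (Metric.ball z R) := Finset.sum_le_sum h1
    _ = _ := by simp; ring

/-! ### From ball ratios to Φ-dimensions -/

theorem upperDimMeasure_le (h : BallRatioLE μ μ.support R₀ C s) (hR₀ : 0 < R₀) (hR₁ : R₀ < 1)
    (hC : 0 < C) (Φ : ℝ → ℝ) : upperDimMeasure Φ μ ≤ s := by
  refine sInf_le ⟨s, ⟨R₀, C, hR₀, hR₁, hC, fun r R hr hrR hRR hR x hx => ?_⟩, rfl⟩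
  have hpos : 0 < μ.real (Metric.ball x r) :=
    ENNReal.toReal_pos ((Measure.mem_support_iff_forall x).1 hx _ (Metric.ball_mem_nhds x hr)).ne'
      (measure_ne_top _ _)
  rw [measure_div_eq_ofReal hpos]
  exact ENNReal.ofReal_le_ofReal ((div_le_iff₀ hpos).2 (h x hx r R hr (hrR.le.trans hRR) hR))

theorem le_lowerDimMeasure (h : BallRatioGE μ μ.support R₀ C s) (hR₀ : 0 < R₀) (hR₁ : R₀ < 1)
    (hC : 0 < C) (Φ : ℝ → ℝ) : (s : EReal) ≤ lowerDimMeasure Φ μ := by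
  refine le_sSup ⟨s, ⟨R₀, C⁻¹, hR₀, hR₁, inv_pos.2 hC, fun r R hr hrR hRR hR x hx => ?_⟩, rfl⟩
  have hpos : 0 < μ.real (Metric.ball x r) :=
    ENNReal.toReal_pos ((Measure.mem_support_iff_forall x).1 hx _ (Metric.ball_mem_nhds x hr)).ne'
      (measure_ne_top _ _)
  rw [measure_div_eq_ofReal hpos]
  refine ENNReal.ofReal_le_ofReal ((le_div_iff₀ hpos).2 ?_)
  rw [mul_assoc, inv_mul_le_iff₀ hC]
  exact h x hx r R hr (hrR.le.trans hRR) hR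

theorem le_of_eventually_rpow_le {s t M : ℝ} (h : ∀ᶠ y : ℝ in atTop, y ^ s ≤ M * y ^ t) :
    s ≤ t := by
  by_contra! hst
  obtain ⟨y, hy, hy0, hyM⟩ := (h.and ((eventually_gt_atTop 0).and
    ((tendsto_rpow_atTop (sub_pos.2 hst)).eventually_gt_atTop M))).exists
  rw [Real.rpow_sub hy0, lt_div_iff₀ (Real.rpow_pos_of_pos hy0 _)] at hyM
  linarith

theorem IsDimensionFunction.rpow_le {Φ : ℝ → ℝ} (hΦ : IsDimensionFunction Φ) {R : ℝ} (hR : 0 < R)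
    (hR₁ : R < 1) : R ^ (1 + Φ R) ≤ R := by
  simpa using Real.rpow_le_rpow_of_exponent_ge hR hR₁.le
    (show (1 : ℝ) ≤ 1 + Φ R by linarith [hΦ.nonneg R ⟨hR, hR₁⟩])

theorem eventually_div_lt {R ε : ℝ} (hε : 0 < ε) : ∀ᶠ y : ℝ in atTop, R / y < ε :=
  (tendsto_const_nhds.div_atTop tendsto_id).eventually_lt_const hε

/-- One point suffices: with `R` fixed and `r = R / y`, the constraint `r < R ^ (1 + Φ R)` holds for
all large `y`, and letting `y → ∞` compares the exponents. -/
theorem le_upperDimMeasure {Φ : ℝ → ℝ} (hΦ : IsDimensionFunction Φ) {x : X} (hx : x ∈ μ.support)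
    (h : BallRatioGE μ {x} R₀ C s) (hC : 0 < C) (hR₀ : 0 < R₀) :
    (s : EReal) ≤ upperDimMeasure Φ μ := by
  refine le_sInf ?_
  rintro _ ⟨t, ⟨C₁, C₂, hC₁, hC₁', hC₂, ht⟩, rfl⟩
  refine EReal.coe_le_coe_iff.2 (le_of_eventually_rpow_le (M := C * C₂) ?_)
  have hR : 0 < min C₁ R₀ := lt_min hC₁ hR₀
  set R := min C₁ R₀
  have hRR := hΦ.rpow_le hR ((min_le_left _ _).trans_lt hC₁')
  filter_upwards [eventually_gt_atTop 0, eventually_div_lt (R := R)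
    (Real.rpow_pos_of_pos hR (1 + Φ R))] with y hy0 hy
  have hr : 0 < R / y := div_pos hR hy0
  have hpos : 0 < μ.real (Metric.ball x (R / y)) :=
    ENNReal.toReal_pos ((Measure.mem_support_iff_forall x).1 hx _ (Metric.ball_mem_nhds x hr)).ne'
      (measure_ne_top _ _)
  have h1 := ht _ R hr hy hRR (min_le_left _ _) x hx
  have h2 := h x rfl _ R hr (hy.le.trans hRR) (min_le_right _ _)
  rw [show R / (R / y) = y by field_simp] at h1 h2
  rw [measure_div_eq_ofReal hpos, ENNReal.ofReal_le_ofReal_iff (by positivity),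
    div_le_iff₀ hpos] at h1
  refine le_of_mul_le_mul_right (h2.trans ?_) hpos
  calc C * μ.real (Metric.ball x R) ≤ C * (C₂ * y ^ t * μ.real (Metric.ball x (R / y))) := by
        gcongr
    _ = _ := by ring

theorem lowerDimMeasure_le {Φ : ℝ → ℝ} (hΦ : IsDimensionFunction Φ) {x : X} (hx : x ∈ μ.support)
    (h : BallRatioLE μ {x} R₀ C s) (hR₀ : 0 < R₀) : lowerDimMeasure Φ μ ≤ s := by
  refine sSup_le ?_
  rintro _ ⟨t, ⟨C₁, C₂, hC₁, hC₁', hC₂, ht⟩, rfl⟩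
  refine EReal.coe_le_coe_iff.2 (le_of_eventually_rpow_le (M := C₂⁻¹ * C) ?_)
  have hR : 0 < min C₁ R₀ := lt_min hC₁ hR₀
  set R := min C₁ R₀
  have hRR := hΦ.rpow_le hR ((min_le_left _ _).trans_lt hC₁')
  filter_upwards [eventually_gt_atTop 0, eventually_div_lt (R := R)
    (Real.rpow_pos_of_pos hR (1 + Φ R))] with y hy0 hy
  have hr : 0 < R / y := div_pos hR hy0
  have hpos : 0 < μ.real (Metric.ball x (R / y)) :=
    ENNReal.toReal_pos ((Measure.mem_support_iff_forall x).1 hx _ (Metric.ball_mem_nhds x hr)).ne'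
      (measure_ne_top _ _)
  have h1 := ht _ R hr hy hRR (min_le_left _ _) x hx
  have h2 := h x rfl _ R hr (hy.le.trans hRR) (min_le_right _ _)
  rw [show R / (R / y) = y by field_simp] at h1 h2
  rw [measure_div_eq_ofReal hpos, ENNReal.ofReal_le_ofReal_iff (by positivity),
    le_div_iff₀ hpos] at h1
  have h3 := le_of_mul_le_mul_right (h1.trans h2) hpos
  rwa [mul_assoc, ← div_eq_inv_mul, le_div_iff₀' hC₂]

theorem upperDimSet_le [OpensMeasurableSpace X] (h : BallRatioLE μ F R₀ C s) (hR₀ : 0 < R₀)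
    (hR₁ : R₀ < 1) (hC : 0 < C) (hF : F ⊆ μ.support) (Φ : ℝ → ℝ) : upperDimSet Φ F ≤ s := by
  refine sInf_le ⟨s, ⟨R₀ / 2, C * 4 ^ s * (C * 2 ^ s), by linarith, by linarith, by positivity,
    fun r R hr hrR hRR hR z hz => ?_⟩, rfl⟩
  have hrR' := hrR.trans hRR
  have hpos : 0 < μ.real (Metric.ball z R) :=
    ENNReal.toReal_pos ((Measure.mem_support_iff_forall z).1 (hF hz) _
      (Metric.ball_mem_nhds z (hr.trans_le hrR'))).ne' (measure_ne_top _ _)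
  set M := C * 4 ^ s * (C * 2 ^ s) * (R / r) ^ s
  have hM : 0 ≤ M := by
    have := hr.trans_le hrR'
    positivity
  have h1 : coveringNumber r (Metric.ball z R ∩ F) ≤ (⌊M⌋₊ : ℕ) :=
    coveringNumber_le_of_card_separated_le hr fun S hSE hS =>
      Nat.le_floor (h.card_separated_le hC.le hz hr hrR' (by linarith) hpos S hSE hS)
  calc (coveringNumber r (Metric.ball z R ∩ F) : ℝ≥0∞) ≤ ((⌊M⌋₊ : ℕ) : ℝ≥0∞) := by
        exact_mod_cast ENat.toENNReal_le.2 h1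
    _ = ENNReal.ofReal (⌊M⌋₊ : ℝ) := (ENNReal.ofReal_natCast _).symm
    _ ≤ ENNReal.ofReal M := ENNReal.ofReal_le_ofReal (Nat.floor_le hM)

theorem le_lowerDimSet (h : BallRatioGE μ F R₀ C s) {q C' : ℝ} (hd : BallRatioLE μ F R₀ C' q)
    (hR₀ : 0 < R₀) (hR₁ : R₀ < 1) (hC : 0 < C) (hC' : 0 < C') (hF : F ⊆ μ.support)
    (hF' : μ Fᶜ = 0) (Φ : ℝ → ℝ) : (s : EReal) ≤ lowerDimSet Φ F := by
  have hM : 0 < C * (C' * 4 ^ q) := by positivity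
  refine le_sSup ⟨s, ⟨R₀ / 4, (C * (C' * 4 ^ q))⁻¹, by linarith, by linarith, inv_pos.2 hM,
    fun r R hr hrR hRR hR z hz => ?_⟩, rfl⟩
  have hrR' := hrR.trans hRR
  have hpos : 0 < μ.real (Metric.ball z R) :=
    ENNReal.toReal_pos ((Measure.mem_support_iff_forall z).1 (hF hz) _
      (Metric.ball_mem_nhds z (hr.trans_le hrR'))).ne' (measure_ne_top _ _)
  -- Cardinalities are integers, so the real lower bound may be rounded up; infinite covers satisfy
  -- it trivially.
  have h1 : ((⌈(C * (C' * 4 ^ q))⁻¹ * (R / r) ^ s⌉₊ : ℕ) : ℕ∞) ≤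
      coveringNumber r (Metric.ball z R ∩ F) := by
    refine le_iInf₂ fun T hT => ?_
    rcases T.finite_or_infinite with hfin | hinf
    · have h2 := h.rpow_le_card_mul hC.le hd hC'.le hF' hz hr hrR' (by linarith) hpos hfin.toFinset
        (by simpa using hT)
      rw [hfin.encard_eq_coe_toFinset_card]
      refine Nat.cast_le.2 (Nat.ceil_le.2 ?_)
      rwa [inv_mul_le_iff₀ hM]
    · rw [hinf.encard_eq]
      exact le_top
  calc _ ≤ ENNReal.ofReal (⌈(C * (C' * 4 ^ q))⁻¹ * (R / r) ^ s⌉₊ : ℝ) :=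
        ENNReal.ofReal_le_ofReal (Nat.le_ceil _)
    _ = ((⌈(C * (C' * 4 ^ q))⁻¹ * (R / r) ^ s⌉₊ : ℕ) : ℝ≥0∞) := ENNReal.ofReal_natCast _
    _ ≤ _ := by exact_mod_cast ENat.toENNReal_le.2 h1

end MetricMeasure

/-! ### Balls and Moran intervals -/

section Moran

variable {Ω₀ : Type*} [MeasurableSpace Ω₀] {K : ℕ} {A B τ : ℝ}

/-- The length of the step `n` Moran interval of the word `i 0, …, i (n-1)`. -/
def moranLength (I : RandomIFS Ω₀ K A B τ) (ω : ℕ → Ω₀) (i : ℕ → Fin K) (n : ℕ) : ℝ :=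
  ∏ k ∈ Finset.range n, I.a (i k) (ω k)

/-- The mass of the step `n` Moran interval of the word `i 0, …, i (n-1)`. -/
def moranMass (p : Ω₀ → stdSimplex ℝ (Fin K)) (ω : ℕ → Ω₀) (i : ℕ → Fin K) (n : ℕ) : ℝ :=
  ∏ k ∈ Finset.range n, (p (ω k)).1 (i k)

variable (I : RandomIFS Ω₀ K A B τ) (p : Ω₀ → stdSimplex ℝ (Fin K)) (ω : ℕ → Ω₀) (i : ℕ → Fin K)

theorem moranLength_pos (hA : 0 < A) (n : ℕ) : 0 < moranLength I ω i n :=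
  Finset.prod_pos fun _ _ => hA.trans_le (I.le_a _ _)

theorem moranLength_succ (n : ℕ) :
    moranLength I ω i (n + 1) = moranLength I ω i n * I.a (i n) (ω n) :=
  Finset.prod_range_succ _ _

theorem antitone_moranLength (hA : 0 < A) (hB : B < 1) : Antitone (moranLength I ω i) :=
  antitone_nat_of_succ_le fun n => by
    rw [moranLength_succ]
    exact mul_le_of_le_one_right (moranLength_pos I ω i hA n).le ((a_le I hA _ _).trans hB.le)

theorem moranLength_le_pow (hA : 0 < A) (n : ℕ) : moranLength I ω i n ≤ B ^ n :=
  (Finset.prod_le_prod (fun _ _ => hA.le.trans (I.le_a _ _)) fun _ _ => a_le I hA _ _).trans_eq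
    (by simp)

theorem tendsto_moranLength (hA : 0 < A) (hB : B < 1) :
    Tendsto (moranLength I ω i) atTop (𝓝 0) :=
  squeeze_zero (fun n => (moranLength_pos I ω i hA n).le) (moranLength_le_pow I ω i hA)
    (tendsto_pow_atTop_nhds_zero_of_lt_one
      ((hA.le.trans (I.le_a (i 0) (ω 0))).trans (a_le I hA _ _)) hB)

theorem dist_le_moranLength (hA : 0 < A) {n : ℕ} {x y : ℝ} (hx : x ∈ moranInterval I ω i n)
    (hy : y ∈ moranInterval I ω i n) : dist x y ≤ moranLength I ω i n := by
  obtain ⟨u, hu, rfl⟩ := hx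
  obtain ⟨v, hv, rfl⟩ := hy
  rw [dist_moranMap I ω i n hu hv]
  refine mul_le_of_le_one_right (moranLength_pos I ω i hA n).le ?_
  rw [Real.dist_eq, abs_le]
  constructor <;> linarith [hu.1, hu.2, hv.1, hv.2]

/-- Points of the Moran set in different step `n` intervals are well separated. -/
theorem mul_moranLength_le_dist (hA : 0 < A) (hB : B < 1) (hτ : 0 < τ) {i' : ℕ → Fin K} {n : ℕ}
    (h : ∃ k < n, i k ≠ i' k) :
    τ * moranLength I ω i n ≤ dist (codingMap I ω i) (codingMap I ω i') := by
  classical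
  have h' : ∃ k, i k ≠ i' k := h.imp fun k hk => hk.2
  obtain ⟨k, hk, hne⟩ := h
  -- At the first disagreement both points lie in the same step `m` interval, in images separated by
  -- `τ` before rescaling by its length.
  set m := Nat.find h'
  have hm : i m ≠ i' m := Nat.find_spec h'
  have hlt : ∀ l < m, i l = i' l := fun l hl => not_not.1 (Nat.find_min h' hl)
  have hmn : m ≤ n := (Nat.find_min' h' hne).trans hk.le
  obtain ⟨u, hu, hxu⟩ := codingMap_mem I hA hB ω i (m + 1)
  obtain ⟨v, hv, hxv⟩ := codingMap_mem I hA hB ω i' (m + 1)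
  rw [← hxu, ← hxv, moranMap, moranMap, ← moranMap_congr I ω hlt, Function.comp, Function.comp,
    dist_moranMap I ω i m (I.mapsTo _ _ hu) (I.mapsTo _ _ hv), mul_comm]
  exact mul_le_mul (antitone_moranLength I ω i hA hB hmn) (I.separated _ _ (ω m) hm u hu v hv)
    hτ.le (moranLength_pos I ω i hA m).le

/-- Stop at the first interval of length at most `ρ`: the last step shrinks by a factor at least
`A`. The bound `ρ ≤ 1` covers stopping at step `0`. -/
theorem exists_moranLength_mem_Icc (hA : 0 < A) (hB : B < 1) {ρ : ℝ} (hρ : 0 < ρ) (hρ₁ : ρ ≤ 1) :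
    ∃ n, A * ρ ≤ moranLength I ω i n ∧ moranLength I ω i n ≤ ρ := by
  classical
  have hex : ∃ n, moranLength I ω i n ≤ ρ :=
    ((tendsto_moranLength I ω i hA hB).eventually_le_const hρ).exists
  refine ⟨Nat.find hex, ?_, Nat.find_spec hex⟩
  have hA1 : A < 1 := (I.le_a (i 0) (ω 0)).trans_lt ((a_le I hA _ _).trans_lt hB)
  rcases h : Nat.find hex with _ | m
  · simp only [moranLength, Finset.range_zero, Finset.prod_empty]
    exact mul_le_one₀ hA1.le hρ.le hρ₁
  · have hm := not_le.1 (Nat.find_min hex (m := m) (by omega))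
    rw [moranLength_succ, mul_comm A]
    exact mul_le_mul hm.le (I.le_a _ _) hA.le (moranLength_pos I ω i hA m).le

theorem measureReal_moranInterval (hA : 0 < A) (hB : B < 1) (hτ : 0 < τ) (n : ℕ) :
    (moranMeasure I p ω).real (moranInterval I ω i n) = moranMass p ω i n := by
  rw [measureReal_def, moranMeasure_moranInterval I hA hB hτ, ENNReal.toReal_prod]
  exact Finset.prod_congr rfl fun k _ => ENNReal.toReal_ofReal ((p (ω k)).2.1 _)

theorem moranMass_le_measureReal_ball (hA : 0 < A) (hB : B < 1) (hτ : 0 < τ) {n : ℕ} {R : ℝ}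
    (hR : moranLength I ω i n < R) :
    moranMass p ω i n ≤ (moranMeasure I p ω).real (Metric.ball (codingMap I ω i) R) := by
  have := isProbabilityMeasure_moranMeasure I hA hB p ω
  rw [← measureReal_moranInterval I p ω i hA hB hτ]
  exact measureReal_mono fun x hx =>
    (dist_le_moranLength I ω i hA hx (codingMap_mem I hA hB ω i n)).trans_lt hR

/-- By separation, every address coding a point of this ball agrees with `i` in its first `n`
digits. -/
theorem measureReal_ball_le_moranMass (hA : 0 < A) (hB : B < 1) (hτ : 0 < τ) {n : ℕ} {R : ℝ}
    (hR : R ≤ τ * moranLength I ω i n) :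
    (moranMeasure I p ω).real (Metric.ball (codingMap I ω i) R) ≤ moranMass p ω i n := by
  have := isProbabilityMeasure_moranMeasure I hA hB p ω
  rw [← measureReal_moranInterval I p ω i hA hB hτ]
  have hc := measurable_codingMap I hA hB ω
  rw [moranMeasure, map_measureReal_apply hc measurableSet_ball,
    map_measureReal_apply hc (isCompact_moranInterval I ω i n).measurableSet]
  refine measureReal_mono fun i' hi' => ?_
  have hi'' : ∀ k < n, i k = i' k := by
    by_contra! h
    have h1 := mul_moranLength_le_dist I ω i hA hB hτ h
    have h2 := Metric.mem_ball'.1 (mem_preimage.1 hi')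
    linarith
  rw [mem_preimage, moranInterval, moranMap_congr I ω hi'']
  exact codingMap_mem I hA hB ω i' n

theorem exists_measureReal_ball_le (hA : 0 < A) (hB : B < 1) (hτ : 0 < τ) {R : ℝ} (hR : 0 < R)
    (hR₁ : R ≤ A * τ) : ∃ n, R / τ ≤ moranLength I ω i n ∧ moranLength I ω i n ≤ R / (A * τ) ∧
      (moranMeasure I p ω).real (Metric.ball (codingMap I ω i) R) ≤ moranMass p ω i n := by
  have hAτ := mul_pos hA hτ
  -- The threshold `R / (A * τ)` makes the guaranteed lower bound exactly `R / τ`, as separation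
  -- requires; that it be at most `1` is the origin of the scale `A * τ`.
  obtain ⟨n, h1, h2⟩ := exists_moranLength_mem_Icc I ω i hA hB (div_pos hR hAτ)
    ((div_le_one hAτ).2 hR₁)
  rw [show A * (R / (A * τ)) = R / τ by field_simp] at h1
  exact ⟨n, h1, h2, measureReal_ball_le_moranMass I p ω i hA hB hτ ((div_le_iff₀' hτ).1 h1)⟩

theorem exists_le_measureReal_ball (hA : 0 < A) (hB : B < 1) (hτ : 0 < τ) {R : ℝ} (hR : 0 < R)
    (hR₁ : R ≤ 1) : ∃ n, A * (R / 2) ≤ moranLength I ω i n ∧ moranLength I ω i n ≤ R / 2 ∧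
      moranMass p ω i n ≤ (moranMeasure I p ω).real (Metric.ball (codingMap I ω i) R) := by
  obtain ⟨n, h1, h2⟩ := exists_moranLength_mem_Icc I ω i hA hB (half_pos hR) (by linarith)
  exact ⟨n, h1, h2, moranMass_le_measureReal_ball I p ω i hA hB hτ (by linarith)⟩

/-- Only the factors between `n` and `m` matter. The comparison is cross-multiplied because weights
may vanish. -/
theorem prod_range_mul_le {f g : ℕ → ℝ} (hf : ∀ k, 0 ≤ f k) (hg : ∀ k, 0 ≤ g k)
    (hfg : ∀ k, f k ≤ g k) {n m : ℕ} (hnm : n ≤ m) :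
    (∏ k ∈ Finset.range m, f k) * ∏ k ∈ Finset.range n, g k ≤
      (∏ k ∈ Finset.range m, g k) * ∏ k ∈ Finset.range n, f k := by
  rw [← Finset.prod_range_mul_prod_Ico f hnm, ← Finset.prod_range_mul_prod_Ico g hnm]
  have h : ∏ k ∈ Finset.Ico n m, f k ≤ ∏ k ∈ Finset.Ico n m, g k :=
    Finset.prod_le_prod (fun k _ => hf k) fun k _ => hfg k
  have h1 : 0 ≤ (∏ k ∈ Finset.range n, f k) * ∏ k ∈ Finset.range n, g k :=
    mul_nonneg (Finset.prod_nonneg fun k _ => hf k) (Finset.prod_nonneg fun k _ => hg k)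
  linarith [mul_le_mul_of_nonneg_left h h1]

theorem moranLength_rpow (hA : 0 < A) (s : ℝ) (n : ℕ) :
    moranLength I ω i n ^ s = ∏ k ∈ Finset.range n, I.a (i k) (ω k) ^ s :=
  (Real.finsetProd_rpow _ _ (fun _ _ => hA.le.trans (I.le_a _ _)) s).symm

theorem moranMass_mul_rpow_le {s : ℝ} (hA : 0 < A)
    (h : ∀ k, I.a (i k) (ω k) ^ s ≤ (p (ω k)).1 (i k)) {n m : ℕ} (hnm : n ≤ m) :
    moranMass p ω i n * moranLength I ω i m ^ s ≤ moranMass p ω i m * moranLength I ω i n ^ s := by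
  have h0 : ∀ k, 0 ≤ I.a (i k) (ω k) ^ s := fun k =>
    Real.rpow_nonneg (hA.le.trans (I.le_a _ _)) _
  rw [moranLength_rpow I ω i hA, moranLength_rpow I ω i hA, mul_comm]
  exact prod_range_mul_le h0 (fun k => (p (ω k)).2.1 _) h hnm

theorem moranMass_mul_rpow_ge {s : ℝ} (hA : 0 < A)
    (h : ∀ k, (p (ω k)).1 (i k) ≤ I.a (i k) (ω k) ^ s) {n m : ℕ} (hnm : n ≤ m) :
    moranMass p ω i m * moranLength I ω i n ^ s ≤ moranMass p ω i n * moranLength I ω i m ^ s := by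
  have h0 : ∀ k, 0 ≤ I.a (i k) (ω k) ^ s := fun k =>
    Real.rpow_nonneg (hA.le.trans (I.le_a _ _)) _
  rw [moranLength_rpow I ω i hA, moranLength_rpow I ω i hA]
  exact (prod_range_mul_le (fun k => (p (ω k)).2.1 _) h0 h hnm).trans_eq (mul_comm _ _)

/-- The large ball is bounded above by an interval of length at most `R / (A * τ)`, the small one
below by an interval of length at least `A * (r / 2)`; the quotient of these lengths gives the
constant. The hypothesis concerns only the address `i`, so it can be applied at a single point. -/
theorem ballRatioLE_moranMeasure {s : ℝ} (hs : 0 ≤ s) (hA : 0 < A) (hB : B < 1) (hτ : 0 < τ)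
    (hτ₁ : τ < 1) (h : ∀ k, I.a (i k) (ω k) ^ s ≤ (p (ω k)).1 (i k)) :
    BallRatioLE (moranMeasure I p ω) {codingMap I ω i} (A * τ) ((2 / (A * A * τ)) ^ s) s := by
  rintro _ rfl r R hr hrR hR
  have hR0 : 0 < R := hr.trans_le hrR
  have hA1 : A < 1 := (I.le_a (i 0) (ω 0)).trans_lt ((a_le I hA _ _).trans_lt hB)
  have hR1 : R ≤ 1 := hR.trans (mul_le_one₀ hA1.le hτ.le hτ₁.le)
  obtain ⟨n, hn1, hn2, hn⟩ := exists_measureReal_ball_le I p ω i hA hB hτ hR0 hR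
  obtain ⟨m, hm1, hm2, hm⟩ := exists_le_measureReal_ball I p ω i hA hB hτ hr (hrR.trans hR1)
  have hRτ : R ≤ R / τ := by
    rw [le_div_iff₀ hτ]
    exact mul_le_of_le_one_right hR0.le hτ₁.le
  -- Otherwise monotonicity would give `R / τ ≤ r / 2`, although `r ≤ R ≤ R / τ`.
  have hnm : n ≤ m := by
    by_contra! hlt
    have := antitone_moranLength I ω i hA hB hlt.le
    linarith
  have hLm := moranLength_pos I ω i hA m
  have hLn := moranLength_pos I ω i hA n
  have h1 := moranMass_mul_rpow_le I p ω i hA h hnm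
  have h2 : moranLength I ω i n / moranLength I ω i m ≤ 2 / (A * A * τ) * (R / r) := by
    calc _ ≤ R / (A * τ) / (A * (r / 2)) := by gcongr
      _ = _ := by field_simp
  calc _ ≤ moranMass p ω i n := hn
    _ ≤ (moranLength I ω i n / moranLength I ω i m) ^ s * moranMass p ω i m := by
        rw [Real.div_rpow hLn.le hLm.le, div_mul_eq_mul_div,
          le_div_iff₀ (Real.rpow_pos_of_pos hLm _)]
        linarith
    _ ≤ (2 / (A * A * τ) * (R / r)) ^ s *
          (moranMeasure I p ω).real (Metric.ball (codingMap I ω i) r) := by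
        gcongr
        exact Finset.prod_nonneg fun k _ => (p (ω k)).2.1 _
    _ = _ := by rw [Real.mul_rpow (by positivity) (by positivity)]

theorem ballRatioGE_moranMeasure {s : ℝ} (hs : 0 ≤ s) (hA : 0 < A) (hB : B < 1) (hτ : 0 < τ)
    (hτ₁ : τ < 1) (h : ∀ k, (p (ω k)).1 (i k) ≤ I.a (i k) (ω k) ^ s) :
    BallRatioGE (moranMeasure I p ω) {codingMap I ω i} (A * τ) ((2 / (A * A * τ)) ^ s) s := by
  have := isProbabilityMeasure_moranMeasure I hA hB p ω
  rintro _ rfl r R hr hrR hR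
  have hR0 : 0 < R := hr.trans_le hrR
  have hA1 : A < 1 := (I.le_a (i 0) (ω 0)).trans_lt ((a_le I hA _ _).trans_lt hB)
  have hR1 : R ≤ 1 := hR.trans (mul_le_one₀ hA1.le hτ.le hτ₁.le)
  obtain ⟨m, hm1, hm2, hm⟩ := exists_measureReal_ball_le I p ω i hA hB hτ hr (hrR.trans hR)
  obtain ⟨n, hn1, hn2, hn⟩ := exists_le_measureReal_ball I p ω i hA hB hτ hR0 hR1
  have hLm := moranLength_pos I ω i hA m
  have hLn := moranLength_pos I ω i hA n
  rcases le_total n m with hnm | hmn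
  · have h1 := moranMass_mul_rpow_ge I p ω i hA h hnm
    have h2 : R / r ≤ 2 / (A * A * τ) * (moranLength I ω i n / moranLength I ω i m) := by
      calc R / r = 2 / (A * A * τ) * (A * (R / 2) / (r / (A * τ))) := by field_simp
        _ ≤ _ := by gcongr
    calc _ ≤ (2 / (A * A * τ) * (moranLength I ω i n / moranLength I ω i m)) ^ s *
          moranMass p ω i m := by gcongr
      _ ≤ (2 / (A * A * τ)) ^ s * moranMass p ω i n := by
          rw [Real.mul_rpow (by positivity) (by positivity), mul_assoc]
          gcongr
          rw [Real.div_rpow hLn.le hLm.le, div_mul_eq_mul_div,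
            div_le_iff₀ (Real.rpow_pos_of_pos hLm _)]
          linarith
      _ ≤ _ := by gcongr
  -- If the levels come in the wrong order, `R / r` is bounded by the constant and monotonicity of
  -- the measure is enough.
  · have hL := antitone_moranLength I ω i hA hB hmn
    have h2 : R / r ≤ 2 / (A * A * τ) := by
      have h3 : A * (R / 2) ≤ r / (A * τ) := by linarith
      rw [le_div_iff₀ (by positivity)] at h3
      rw [div_le_div_iff₀ hr (by positivity)]
      linarith
    gcongr
    exact measure_ne_top _ _

/-! ### The Moran set is the support of the Moran measure -/

theorem moranSet_eq_range (hA : 0 < A) (hB : B < 1) (hτ : 0 < τ) :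
    moranSet I ω = range (codingMap I ω) := by
  refine Subset.antisymm (fun x hx => ?_) ?_
  · choose f hf using fun n => mem_iUnion.1 (mem_iInter.1 hx n)
    -- Step `k + 1` is the first that determines digit `k`; uniqueness of words makes the choices at
    -- all later steps agree with it.
    refine ⟨fun k => f (k + 1) k, ?_⟩
    have hmem : ∀ n, x ∈ moranInterval I ω (fun k => f (k + 1) k) n := fun n => by
      have hcongr : ∀ k < n, f (k + 1) k = f n k := fun k hk =>
        eq_of_mem_moranInterval I hA hτ ω (hf (k + 1))
          (moranInterval_antitone I ω (f n) (Nat.succ_le_of_lt hk) (hf n)) k (Nat.lt_succ_self k)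
      rw [moranInterval, moranMap_congr I ω hcongr]
      exact hf n
    refine dist_le_zero.1 (ge_of_tendsto' (tendsto_moranLength I ω (fun k => f (k + 1) k) hA hB)
      fun n => dist_le_moranLength I ω _ hA (codingMap_mem I hA hB ω _ n) (hmem n))
  · rintro _ ⟨i, rfl⟩
    exact mem_iInter.2 fun n => mem_iUnion.2 ⟨i, codingMap_mem I hA hB ω i n⟩

theorem isClosed_moranSet : IsClosed (moranSet I ω) := by
  classical
  refine isClosed_iInter fun n => ?_
  rcases isEmpty_or_nonempty (ℕ → Fin K) with he | ⟨⟨i₀⟩⟩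
  · simp
  -- A step `n` interval depends only on the first `n` digits; the rest of the word is padded with
  -- the arbitrary digit `i₀ 0`.
  have hfin : (range fun i : ℕ → Fin K => moranInterval I ω i n).Finite := by
    refine (Set.finite_range fun w : Fin n → Fin K =>
      moranInterval I ω (fun k => if h : k < n then w ⟨k, h⟩ else i₀ 0) n).subset ?_
    rintro _ ⟨i, rfl⟩
    refine ⟨fun k => i k, ?_⟩
    simp only [moranInterval]
    rw [moranMap_congr I ω (i' := i) fun k hk => by simp [hk]]
  rw [← sUnion_range, sUnion_eq_biUnion]
  refine hfin.isClosed_biUnion ?_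
  rintro _ ⟨i, rfl⟩
  exact (isCompact_moranInterval I ω i n).isClosed

theorem moranMeasure_compl_moranSet (hA : 0 < A) (hB : B < 1) (hτ : 0 < τ) :
    moranMeasure I p ω (moranSet I ω)ᶜ = 0 := by
  rw [moranMeasure, Measure.map_apply (measurable_codingMap I hA hB ω)
    (isClosed_moranSet I ω).measurableSet.compl]
  rw [moranSet_eq_range I ω hA hB hτ, preimage_compl, preimage_range, compl_univ, measure_empty]

theorem support_moranMeasure (hA : 0 < A) (hB : B < 1) (hτ : 0 < τ)
    (hp : ∀ ω j, 0 < (p ω).1 j) : (moranMeasure I p ω).support = moranSet I ω := by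
  refine Subset.antisymm (Measure.support_subset_of_isClosed (isClosed_moranSet I ω)
    (moranMeasure_compl_moranSet I p ω hA hB hτ)) ?_
  rw [moranSet_eq_range I ω hA hB hτ]
  rintro _ ⟨i, rfl⟩
  refine (Measure.mem_support_iff_forall _).2 fun U hU => ?_
  obtain ⟨R, hR, hRU⟩ := Metric.mem_nhds_iff.1 hU
  obtain ⟨n, hn⟩ := ((tendsto_moranLength I ω i hA hB).eventually_lt_const hR).exists
  have h := moranMass_le_measureReal_ball I p ω i hA hB hτ hn
  have hpos : 0 < moranMass p ω i n := Finset.prod_pos fun k _ => hp _ _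
  exact (ENNReal.toReal_pos_iff.1 (hpos.trans_le h)).1.trans_le (measure_mono hRU)

end Moran

/-! ### The weights -/

section Weights

variable {K : ℕ} {A B : ℝ}

/-- The admissible families of contraction factors. -/
def factorSet (K : ℕ) (A B : ℝ) : Set (Fin K → ℝ) :=
  {c | (∀ j, A ≤ c j) ∧ ∑ j, c j ≤ B}

theorem measurableSet_factorSet : MeasurableSet (factorSet K A B) := by
  have h : factorSet K A B = (⋂ j, {c | A ≤ c j}) ∩ {c | ∑ j, c j ≤ B} := by
    ext c
    simp [factorSet]
  rw [h]
  exact (MeasurableSet.iInter fun j => measurableSet_le measurable_const (measurable_pi_apply j)).inter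
    (measurableSet_le (by fun_prop) measurable_const)

theorem le_of_mem_factorSet (hA : 0 < A) {c : Fin K → ℝ} (hc : c ∈ factorSet K A B) (j : Fin K) :
    c j ≤ B :=
  (Finset.single_le_sum (f := c) (fun k _ => hA.le.trans (hc.1 k)) (Finset.mem_univ j)).trans hc.2

theorem moranExponent_spec (hK : 2 ≤ K) (hA : 0 < A) (hB : B < 1) {c : Fin K → ℝ}
    (hc : c ∈ factorSet K A B) : 0 ≤ moranExponent c ∧ ∑ j, c j ^ moranExponent c = 1 := by
  obtain ⟨s, hs, huniq⟩ := existsUnique_moranExponent hK c (fun j => hA.trans_le (hc.1 j))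
    (hc.2.trans_lt hB)
  have h : moranExponent c = s := by
    have h1 : {s : ℝ | 0 ≤ s ∧ ∑ j, c j ^ s = 1} = {s} :=
      Set.eq_singleton_iff_unique_mem.2 ⟨hs, huniq⟩
    rw [moranExponent, h1, csInf_singleton]
  rw [h]
  exact hs

theorem strictAnti_sum_rpow (hA : 0 < A) (hB : B < 1) {c : Fin K → ℝ} (hc : c ∈ factorSet K A B)
    {S : Finset (Fin K)} (hS : S.Nonempty) : StrictAnti fun t : ℝ => ∑ j ∈ S, c j ^ t :=
  fun _ _ hst => Finset.sum_lt_sum_of_nonempty hS fun j _ =>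
    Real.rpow_lt_rpow_of_exponent_gt (hA.trans_le (hc.1 j))
      ((le_of_mem_factorSet hA hc j).trans_lt hB) hst

theorem moranExponent_pos (hK : 2 ≤ K) (hA : 0 < A) (hB : B < 1) {c : Fin K → ℝ}
    (hc : c ∈ factorSet K A B) : 0 < moranExponent c := by
  obtain ⟨h0, h1⟩ := moranExponent_spec hK hA hB hc
  refine h0.lt_of_ne fun h => ?_
  rw [← h] at h1
  simp only [Real.rpow_zero, Finset.sum_const, Finset.card_univ, Fintype.card_fin, nsmul_eq_mul,
    mul_one, Nat.cast_eq_one] at h1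
  omega

theorem moranExponent_le_one (hK : 2 ≤ K) (hA : 0 < A) (hB : B < 1) {c : Fin K → ℝ}
    (hc : c ∈ factorSet K A B) : moranExponent c ≤ 1 := by
  have : Nonempty (Fin K) := ⟨⟨0, by omega⟩⟩
  refine (strictAnti_sum_rpow hA hB hc Finset.univ_nonempty).le_iff_ge.1 ?_
  simpa [(moranExponent_spec hK hA hB hc).2] using hc.2.trans hB.le

/-- By the intermediate value theorem: at `t = 0` the sum is `K - 1 ≥ 1`, and it is at most `K * B ^
t`, while the target is at least `1 - B ^ r > 0`. Hence `M` is uniform in `c`, which later keeps the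
weights away from zero. -/
theorem exists_rpow_sum_erase_eq (hK : 2 ≤ K) (hA : 0 < A) (hB : B < 1) {r : ℝ} (hr : 0 < r)
    (z : Fin K) : ∃ M : ℝ, ∀ c ∈ factorSet K A B, ∃ t : ℝ, 0 ≤ t ∧ t ≤ M ∧
      ∑ j ∈ Finset.univ.erase z, c j ^ t = 1 - c z ^ r := by
  rcases (factorSet K A B).eq_empty_or_nonempty with he | ⟨c₀, hc₀⟩
  · exact ⟨0, by simp [he]⟩
  have hB0 : 0 < B := hA.trans_le ((hc₀.1 z).trans (le_of_mem_factorSet hA hc₀ z))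
  have hδ : 0 < 1 - B ^ r := sub_pos.2 (Real.rpow_lt_one hB0.le hB hr)
  have hlim : Tendsto (fun t : ℝ => (K : ℝ) * B ^ t) atTop (𝓝 0) := by
    simpa using (tendsto_rpow_atTop_of_base_lt_one B (by linarith) hB).const_mul (K : ℝ)
  obtain ⟨M, hM, hM0⟩ := ((hlim.eventually_le_const hδ).and (eventually_ge_atTop 0)).exists
  refine ⟨M, fun c hc => ?_⟩
  have hpos : ∀ j, 0 < c j := fun j => hA.trans_le (hc.1 j)
  have hcont : Continuous fun t : ℝ => ∑ j ∈ Finset.univ.erase z, c j ^ t :=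
    continuous_finsetSum _ fun j _ => Real.continuous_const_rpow (hpos j).ne'
  have h0 : 1 - c z ^ r ≤ ∑ j ∈ Finset.univ.erase z, c j ^ (0 : ℝ) := by
    simp only [Real.rpow_zero, Finset.sum_const, nsmul_eq_mul, mul_one,
      Finset.card_erase_of_mem (Finset.mem_univ z), Finset.card_univ, Fintype.card_fin]
    have h1 : (1 : ℝ) ≤ ((K - 1 : ℕ) : ℝ) := by exact_mod_cast (by omega : 1 ≤ K - 1)
    have := Real.rpow_nonneg (hpos z).le r
    linarith
  have h1 : ∑ j ∈ Finset.univ.erase z, c j ^ M ≤ 1 - c z ^ r := by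
    calc _ ≤ ∑ j ∈ Finset.univ.erase z, B ^ M := Finset.sum_le_sum fun j _ =>
          Real.rpow_le_rpow (hpos j).le (le_of_mem_factorSet hA hc j) hM0
      _ ≤ ∑ j : Fin K, B ^ M := Finset.sum_le_sum_of_subset_of_nonneg (Finset.erase_subset _ _)
          fun _ _ _ => Real.rpow_nonneg hB0.le _
      _ = K * B ^ M := by simp
      _ ≤ 1 - B ^ r := hM
      _ ≤ 1 - c z ^ r := by
          have := Real.rpow_le_rpow (hpos z).le (le_of_mem_factorSet hA hc z) hr.le
          linarith
  obtain ⟨t, ht, ht1⟩ := intermediate_value_Icc' hM0 hcont.continuousOn ⟨h1, h0⟩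
  exact ⟨t, ht.1, ht.2, ht1⟩

/-- The exponent `t` with `c z ^ r + ∑ j ≠ z, c j ^ t = 1` depends measurably on `c`. -/
theorem exists_measurable_exponent (hK : 2 ≤ K) (hA : 0 < A) (hB : B < 1) {r : ℝ} (hr : 0 < r)
    (z : Fin K) : ∃ ρ : (Fin K → ℝ) → ℝ, Measurable ρ ∧ ∃ M : ℝ, ∀ c ∈ factorSet K A B,
      0 ≤ ρ c ∧ ρ c ≤ M ∧ ∑ j ∈ Finset.univ.erase z, c j ^ ρ c = 1 - c z ^ r := by
  classical
  obtain ⟨M, hM⟩ := exists_rpow_sum_erase_eq hK hA hB hr z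
  choose! ρ hρ using hM
  refine ⟨(factorSet K A B).indicator ρ, ?_, M, fun c hc => ?_⟩
  · refine measurable_of_Iic fun t => ?_
    have hne : (Finset.univ.erase z).Nonempty := by
      rw [← Finset.card_pos, Finset.card_erase_of_mem (Finset.mem_univ z), Finset.card_univ,
        Fintype.card_fin]
      omega
    -- Although `ρ` is obtained by choice, strict monotonicity in the exponent turns `ρ c ≤ t` into
    -- an explicit inequality in `c`. Outside `factorSet` the value is `0`.
    have h : (factorSet K A B).indicator ρ ⁻¹' Iic t =
        (factorSet K A B ∩ {c | ∑ j ∈ Finset.univ.erase z, c j ^ t ≤ 1 - c z ^ r}) ∪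
        ((factorSet K A B)ᶜ ∩ {_c | 0 ≤ t}) := by
      ext c
      by_cases hc : c ∈ factorSet K A B
      · have h1 := (strictAnti_sum_rpow hA hB hc hne).le_iff_ge (a := t) (b := ρ c)
        simp only [(hρ c hc).2.2] at h1
        simp only [mem_preimage, indicator_of_mem hc, mem_Iic, mem_union, mem_inter_iff, hc,
          true_and, mem_ofPred_eq, h1, mem_compl_iff, not_true, false_and, or_false]
      · simp [hc]
    rw [h]
    refine (measurableSet_factorSet.inter (measurableSet_le ?_ ?_)).union
      (measurableSet_factorSet.compl.inter (MeasurableSet.const _)) <;> fun_prop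
  · rw [indicator_of_mem hc]
    exact hρ c hc

/-- Here `∑ j, c j ^ r ≤ 1`, so over `j ≠ z` the exponent `r` gives a sum no larger than `ρ` does.
-/
theorem exponent_le_of_moranExponent_le (hK : 2 ≤ K) (hA : 0 < A) (hB : B < 1) {r ρ : ℝ}
    {z : Fin K} {c : Fin K → ℝ} (hc : c ∈ factorSet K A B)
    (hρ : ∑ j ∈ Finset.univ.erase z, c j ^ ρ = 1 - c z ^ r) (h : moranExponent c ≤ r) :
    ρ ≤ r := by
  have : Nonempty (Fin K) := ⟨z⟩
  have hne : (Finset.univ.erase z).Nonempty := by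
    rw [← Finset.card_pos, Finset.card_erase_of_mem (Finset.mem_univ z), Finset.card_univ,
      Fintype.card_fin]
    omega
  have h1 := (strictAnti_sum_rpow hA hB hc Finset.univ_nonempty).antitone h
  simp only [(moranExponent_spec hK hA hB hc).2] at h1
  rw [← Finset.add_sum_erase _ _ (Finset.mem_univ z)] at h1
  refine (strictAnti_sum_rpow hA hB hc hne).le_iff_ge.1 ?_
  linarith

theorem le_exponent_of_le_moranExponent (hK : 2 ≤ K) (hA : 0 < A) (hB : B < 1) {r ρ : ℝ}
    {z : Fin K} {c : Fin K → ℝ} (hc : c ∈ factorSet K A B)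
    (hρ : ∑ j ∈ Finset.univ.erase z, c j ^ ρ = 1 - c z ^ r) (h : r ≤ moranExponent c) :
    r ≤ ρ := by
  have : Nonempty (Fin K) := ⟨z⟩
  have hne : (Finset.univ.erase z).Nonempty := by
    rw [← Finset.card_pos, Finset.card_erase_of_mem (Finset.mem_univ z), Finset.card_univ,
      Fintype.card_fin]
    omega
  have h1 := (strictAnti_sum_rpow hA hB hc Finset.univ_nonempty).antitone h
  simp only [(moranExponent_spec hK hA hB hc).2] at h1
  rw [← Finset.add_sum_erase _ _ (Finset.mem_univ z)] at h1
  refine (strictAnti_sum_rpow hA hB hc hne).le_iff_ge.1 ?_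
  linarith

end Weights

/-! ### Random weights with digitwise bounds -/

section RandomWeights

variable {Ω₀ : Type*} [MeasurableSpace Ω₀] {K : ℕ} {A B τ : ℝ}

theorem RandomIFS.factors_mem (I : RandomIFS Ω₀ K A B τ) (ω : Ω₀) :
    (fun j => I.a j ω) ∈ factorSet K A B :=
  ⟨fun j => I.le_a j ω, I.sum_a_le ω⟩

/-- Existence of the weights `a z ^ r` and `a j ^ ρ`, `j ≠ z`. -/
theorem exists_weights (P : Measure Ω₀) [IsProbabilityMeasure P] (hK : 2 ≤ K) (hA : 0 < A)
    (hB : B < 1) (I : RandomIFS Ω₀ K A B τ) {r : ℝ} (hr : 0 < r) (z : Fin K) :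
    ∃ ρ : (Fin K → ℝ) → ℝ, Measurable ρ ∧ ∃ p : Ω₀ → stdSimplex ℝ (Fin K), IsAdmissible P p ∧
      (∀ ω j, (p ω).1 j = if j = z then I.a j ω ^ r else I.a j ω ^ ρ (fun k => I.a k ω)) ∧
      (∃ ε : ℝ, 0 < ε ∧ ∀ ω j, ε ≤ (p ω).1 j) ∧
      (∀ ω, (moranExponent fun j => I.a j ω) ≤ r → ∀ j, I.a j ω ^ r ≤ (p ω).1 j) ∧
      (∀ ω, r ≤ (moranExponent fun j => I.a j ω) → ∀ j, (p ω).1 j ≤ I.a j ω ^ r) := by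
  classical
  obtain ⟨ρ, hρm, M, hρ⟩ := exists_measurable_exponent hK hA hB hr z
  have hpos : ∀ j ω, 0 < I.a j ω := fun j ω => hA.trans_le (I.le_a j ω)
  have hlt : ∀ j ω, I.a j ω < 1 := fun j ω => (a_le I hA j ω).trans_lt hB
  set w : Ω₀ → Fin K → ℝ := fun ω j =>
    if j = z then I.a j ω ^ r else I.a j ω ^ ρ (fun k => I.a k ω) with hw
  have hw1 : ∀ ω, w ω ∈ stdSimplex ℝ (Fin K) := by
    refine fun ω => ⟨fun j => ?_, ?_⟩
    · simp only [hw]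
      split_ifs <;> exact Real.rpow_nonneg (hpos _ _).le _
    · rw [← Finset.add_sum_erase _ _ (Finset.mem_univ z), Finset.sum_congr rfl
        (g := fun j => I.a j ω ^ ρ (fun k => I.a k ω))
        fun j hj => by simp [hw, Finset.ne_of_mem_erase hj], (hρ _ (I.factors_mem ω)).2.2]
      simp [hw]
  have hwm : ∀ j, Measurable fun ω => w ω j := by
    intro j
    have hρm' : Measurable fun ω => ρ fun k => I.a k ω :=
      hρm.comp (measurable_pi_lambda _ fun k => I.measurable_a k)
    simp only [hw]
    split_ifs
    · exact (I.measurable_a j).pow_const r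
    · exact (I.measurable_a j).pow hρm'
  -- The factors are at least `A` and the exponents are `r` or at most `M`.
  have hε : ∀ ω j, min (A ^ r) (A ^ M) ≤ w ω j := by
    intro ω j
    have h := hρ _ (I.factors_mem ω)
    have hA1 : A ≤ 1 := (I.le_a j ω).trans (hlt j ω).le
    simp only [hw]
    split_ifs
    · exact (min_le_left _ _).trans (Real.rpow_le_rpow hA.le (I.le_a j ω) hr.le)
    · exact (min_le_right _ _).trans ((Real.rpow_le_rpow_of_exponent_ge hA hA1 h.2.1).trans
        (Real.rpow_le_rpow hA.le (I.le_a j ω) h.1))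
  have hε0 : 0 < min (A ^ r) (A ^ M) :=
    lt_min (Real.rpow_pos_of_pos hA _) (Real.rpow_pos_of_pos hA _)
  refine ⟨ρ, hρm, fun ω => ⟨w ω, hw1 ω⟩,
    ⟨(measurable_pi_lambda _ hwm).subtype_mk, 1, one_pos, fun j => ?_⟩, fun _ _ => rfl,
    ⟨_, hε0, hε⟩, fun ω hω j => ?_, fun ω hω j => ?_⟩
  · calc ∫⁻ ω, ENNReal.ofReal (w ω j) ^ (-1 : ℝ) ∂P
        ≤ ∫⁻ _, ENNReal.ofReal (min (A ^ r) (A ^ M)) ^ (-1 : ℝ) ∂P := by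
          refine lintegral_mono fun ω => ?_
          rw [ENNReal.rpow_neg_one, ENNReal.rpow_neg_one]
          exact ENNReal.inv_le_inv.2 (ENNReal.ofReal_le_ofReal (hε ω j))
      _ < ∞ := by
          rw [lintegral_const, measure_univ, mul_one, ENNReal.rpow_neg_one]
          exact ENNReal.inv_lt_top.2 (ENNReal.ofReal_pos.2 hε0)
  · have h := exponent_le_of_moranExponent_le hK hA hB (I.factors_mem ω)
      (hρ _ (I.factors_mem ω)).2.2 hω
    simp only [hw]
    split_ifs
    · exact le_rfl
    · exact Real.rpow_le_rpow_of_exponent_ge (hpos j ω) (hlt j ω).le h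
  · have h := le_exponent_of_le_moranExponent hK hA hB (I.factors_mem ω)
      (hρ _ (I.factors_mem ω)).2.2 hω
    simp only [hw]
    split_ifs
    · exact le_rfl
    · exact Real.rpow_le_rpow_of_exponent_ge (hpos j ω) (hlt j ω).le h

theorem ae_infinitePi_forall {P : Measure Ω₀} [IsProbabilityMeasure P] {q : Ω₀ → Prop}
    (h : ∀ᵐ ω ∂P, q ω) : ∀ᵐ ω ∂(Measure.infinitePi fun _ : ℕ => P), ∀ n, q (ω n) :=
  ae_all_iff.2 fun n =>
    (measurePreserving_eval_infinitePi (fun _ : ℕ => P) n).quasiMeasurePreserving.ae h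

/-! ### Dimensions for a fixed sequence satisfying the digitwise bounds -/

variable (I : RandomIFS Ω₀ K A B τ) (p : Ω₀ → stdSimplex ℝ (Fin K)) (ω : ℕ → Ω₀)

theorem ballRatioLE_moranSet {s : ℝ} (hs : 0 ≤ s) (hA : 0 < A) (hB : B < 1) (hτ : 0 < τ)
    (hτ₁ : τ < 1) (h : ∀ n j, I.a j (ω n) ^ s ≤ (p (ω n)).1 j) :
    BallRatioLE (moranMeasure I p ω) (moranSet I ω) (A * τ) ((2 / (A * A * τ)) ^ s) s := by
  rw [moranSet_eq_range I ω hA hB hτ]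
  rintro _ ⟨i, rfl⟩
  exact ballRatioLE_moranMeasure I p ω i hs hA hB hτ hτ₁ (fun k => h k _) _ rfl

theorem ballRatioGE_moranSet {s : ℝ} (hs : 0 ≤ s) (hA : 0 < A) (hB : B < 1) (hτ : 0 < τ)
    (hτ₁ : τ < 1) (h : ∀ n j, (p (ω n)).1 j ≤ I.a j (ω n) ^ s) :
    BallRatioGE (moranMeasure I p ω) (moranSet I ω) (A * τ) ((2 / (A * A * τ)) ^ s) s := by
  rw [moranSet_eq_range I ω hA hB hτ]
  rintro _ ⟨i, rfl⟩
  exact ballRatioGE_moranMeasure I p ω i hs hA hB hτ hτ₁ (fun k => h k _) _ rfl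

variable {r ε : ℝ} {z : Fin K} {Φ : ℝ → ℝ}

theorem upperDim_eq_and_le (hr : 0 ≤ r) (hA : 0 < A) (hA₁ : A < 1) (hB : B < 1) (hτ : 0 < τ)
    (hτ₁ : τ < 1) (hp : ∀ ω j, 0 < (p ω).1 j) (hz : ∀ ω, (p ω).1 z = I.a z ω ^ r)
    (h : ∀ n j, I.a j (ω n) ^ r ≤ (p (ω n)).1 j) (hΦ : IsDimensionFunction Φ) :
    upperDimMeasure Φ (moranMeasure I p ω) = r ∧ upperDimSet Φ (moranSet I ω) ≤ r := by
  have := isProbabilityMeasure_moranMeasure I hA hB p ω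
  have hU := ballRatioLE_moranSet I p ω hr hA hB hτ hτ₁ h
  have hsupp := support_moranMeasure I p ω hA hB hτ hp
  have hR₀ : 0 < A * τ := mul_pos hA hτ
  have hR₁ : A * τ < 1 := mul_lt_one_of_nonneg_of_lt_one_left hA.le hA₁ hτ₁.le
  have hC : 0 < (2 / (A * A * τ)) ^ r := by positivity
  refine ⟨le_antisymm (upperDimMeasure_le (hsupp ▸ hU) hR₀ hR₁ hC Φ) ?_,
    upperDimSet_le hU hR₀ hR₁ hC hsupp.ge Φ⟩
  -- Along the constant address `z` the weights equal `a z ^ r`, so the reverse ball estimate holds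
  -- there.
  refine le_upperDimMeasure hΦ (x := codingMap I ω fun _ => z) ?_
    (ballRatioGE_moranMeasure I p ω (fun _ => z) hr hA hB hτ hτ₁ fun k => (hz _).le) hC hR₀
  rw [hsupp, moranSet_eq_range I ω hA hB hτ]
  exact mem_range_self _

theorem lowerDim_eq_and_ge (hr : 0 ≤ r) (hA : 0 < A) (hA₁ : A < 1) (hB : B < 1) (hτ : 0 < τ)
    (hτ₁ : τ < 1) (hε : 0 < ε) (hp : ∀ ω j, ε ≤ (p ω).1 j) (hz : ∀ ω, (p ω).1 z = I.a z ω ^ r)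
    (h : ∀ n j, (p (ω n)).1 j ≤ I.a j (ω n) ^ r) (hΦ : IsDimensionFunction Φ) :
    lowerDimMeasure Φ (moranMeasure I p ω) = r ∧ (r : EReal) ≤ lowerDimSet Φ (moranSet I ω) := by
  have := isProbabilityMeasure_moranMeasure I hA hB p ω
  have hV := ballRatioGE_moranSet I p ω hr hA hB hτ hτ₁ h
  have hsupp := support_moranMeasure I p ω hA hB hτ fun ω j => hε.trans_le (hp ω j)
  have hR₀ : 0 < A * τ := mul_pos hA hτ
  have hR₁ : A * τ < 1 := mul_lt_one_of_nonneg_of_lt_one_left hA.le hA₁ hτ₁.le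
  have hC : ∀ s : ℝ, 0 < (2 / (A * A * τ)) ^ s := fun s => by positivity
  have hB0 : 0 < B := hA.trans_le ((I.le_a z (ω 0)).trans (a_le I hA _ _))
  -- A crude exponent with `B ^ q ≤ ε` gives `a j ^ q ≤ p j`, which supplies the doubling needed for
  -- the covering bound.
  obtain ⟨q, hq, hq0⟩ := (((tendsto_rpow_atTop_of_base_lt_one B (by linarith)
    hB).eventually_le_const hε).and (eventually_ge_atTop 0)).exists
  have hU := ballRatioLE_moranSet I p ω hq0 hA hB hτ hτ₁ fun n j =>
    ((Real.rpow_le_rpow (hA.le.trans (I.le_a j _)) (a_le I hA j _) hq0).trans hq).trans (hp _ j)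
  refine ⟨le_antisymm ?_ (le_lowerDimMeasure (hsupp.symm ▸ hV) hR₀ hR₁ (hC r) Φ),
    le_lowerDimSet hV hU hR₀ hR₁ (hC r) (hC q) hsupp.ge
      (moranMeasure_compl_moranSet I p ω hA hB hτ) Φ⟩
  refine lowerDimMeasure_le hΦ (x := codingMap I ω fun _ => z) ?_
    (ballRatioLE_moranMeasure I p ω (fun _ => z) hr hA hB hτ hτ₁ fun k => (hz _).ge) hR₀
  rw [hsupp, moranSet_eq_range I ω hA hB hτ]
  exact mem_range_self _

end RandomWeights

end RandomMoran

end

/-! ### The almost sure statement -/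

theorem mainTheorem2 {Ω₀ : Type*} [MeasurableSpace Ω₀] (P : Measure Ω₀) [IsProbabilityMeasure P]
    (K : ℕ) (hK : 2 ≤ K) (A B τ : ℝ) (hA : 0 < A) (hAB : K * A ≤ B) (hB : B < 1) (hτ : 0 < τ)
    (hτB : τ ≤ (1 - B) / K) (I : RandomMoran.RandomIFS Ω₀ K A B τ) :
    (∀ r : ℝ, essSup (fun ω => RandomMoran.moranExponent fun j => I.a j ω) P ≤ r →
      ∃ ρ : (Fin K → ℝ) → ℝ, Measurable ρ ∧
      ∃ p : Ω₀ → stdSimplex ℝ (Fin K), RandomMoran.IsAdmissible P p ∧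
        (∀ ω j, (p ω).1 j =
          if (j : ℕ) = 0 then I.a j ω ^ r else I.a j ω ^ ρ (fun k => I.a k ω)) ∧
        (∃ ε : ℝ, 0 < ε ∧ ∀ ω j, ε ≤ (p ω).1 j) ∧
        ∀ᵐ ω ∂(Measure.infinitePi fun _ : ℕ => P), ∀ Φ : ℝ → ℝ,
          RandomMoran.IsDimensionFunction Φ → RandomMoran.IsSmall Φ →
            RandomMoran.upperDimMeasure Φ (RandomMoran.moranMeasure I p ω) = (r : EReal) ∧
            RandomMoran.upperDimSet Φ (RandomMoran.moranSet I ω) ≤ (r : EReal)) ∧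
    (∀ r : ℝ, 0 < r → r ≤ essInf (fun ω => RandomMoran.moranExponent fun j => I.a j ω) P →
      ∃ ρ : (Fin K → ℝ) → ℝ, Measurable ρ ∧
      ∃ p : Ω₀ → stdSimplex ℝ (Fin K), RandomMoran.IsAdmissible P p ∧
        (∀ ω j, (p ω).1 j =
          if (j : ℕ) = 0 then I.a j ω ^ r else I.a j ω ^ ρ (fun k => I.a k ω)) ∧
        (∃ ε : ℝ, 0 < ε ∧ ∀ ω j, ε ≤ (p ω).1 j) ∧
        ∀ᵐ ω ∂(Measure.infinitePi fun _ : ℕ => P), ∀ Φ : ℝ → ℝ,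
          RandomMoran.IsDimensionFunction Φ → RandomMoran.IsSmall Φ →
            RandomMoran.lowerDimMeasure Φ (RandomMoran.moranMeasure I p ω) = (r : EReal) ∧
            (r : EReal) ≤ RandomMoran.lowerDimSet Φ (RandomMoran.moranSet I ω)) := by
  have hK' : (2 : ℝ) ≤ K := by exact_mod_cast hK
  have hA₁ : A < 1 := by nlinarith
  have hτ₁ : τ < 1 := by
    rw [le_div_iff₀ (by linarith)] at hτB
    nlinarith
  have hz : ∀ j : Fin K, (j : ℕ) = 0 ↔ j = ⟨0, by omega⟩ := fun j => by rw [Fin.ext_iff]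
  simp only [hz]
  refine ⟨fun r hr => ?_, fun r hr0 hr => ?_⟩
  · have hD : ∀ᵐ ω ∂P, (RandomMoran.moranExponent fun j => I.a j ω) ≤ r :=
      -- The real-valued essential supremum is meaningful only for a function bounded above; Moran
      -- exponents are at most `1`.
      (ae_le_essSup (isBoundedUnder_of ⟨1, fun ω =>
        RandomMoran.moranExponent_le_one hK hA hB (I.factors_mem ω)⟩)).mono fun ω hω => hω.trans hr
    -- Positivity of `r` follows from one sample point, since every Moran exponent is positive.
    obtain ⟨ω₀, hω₀⟩ := hD.exists
    have hr0 : 0 < r := (RandomMoran.moranExponent_pos hK hA hB (I.factors_mem ω₀)).trans_le hω₀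
    obtain ⟨ρ, hρ, p, hp, hpz, ⟨ε, hε, hpε⟩, hle, -⟩ :=
      RandomMoran.exists_weights P hK hA hB I hr0 ⟨0, by omega⟩
    refine ⟨ρ, hρ, p, hp, hpz, ⟨ε, hε, hpε⟩, ?_⟩
    filter_upwards [RandomMoran.ae_infinitePi_forall hD] with ω hω Φ hΦ _
    exact RandomMoran.upperDim_eq_and_le I p ω hr0.le hA hA₁ hB hτ hτ₁
      (fun ω j => hε.trans_le (hpε ω j)) (fun ω => by rw [hpz, if_pos rfl])
      (fun n => hle _ (hω n)) hΦ
  · have hd : ∀ᵐ ω ∂P, r ≤ (RandomMoran.moranExponent fun j => I.a j ω) :=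
      (ae_essInf_le (isBoundedUnder_of ⟨0, fun ω =>
        (RandomMoran.moranExponent_pos hK hA hB (I.factors_mem ω)).le⟩)).mono
          fun ω hω => hr.trans hω
    obtain ⟨ρ, hρ, p, hp, hpz, ⟨ε, hε, hpε⟩, -, hge⟩ :=
      RandomMoran.exists_weights P hK hA hB I hr0 ⟨0, by omega⟩
    refine ⟨ρ, hρ, p, hp, hpz, ⟨ε, hε, hpε⟩, ?_⟩
    filter_upwards [RandomMoran.ae_infinitePi_forall hd] with ω hω Φ hΦ _
    exact RandomMoran.lowerDim_eq_and_ge I p ω hr0.le hA hA₁ hB hτ hτ₁ hε hpε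
      (fun ω => by rw [hpz, if_pos rfl]) (fun n => hge _ (hω n)) hΦ
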